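/- Let $X(t)$, $t\in\mathbb R$, be a real zero-mean stationary finite-variance process (for instance Gaussian; only wide-sense stationarity is used) with power spectral density $S_X\ge 0$, $S_X\in L^1(\mathbb R)$, i.e. $\mathbb E[X(t+\tau)X(t)]=\int_{\mathbb R} S_X(f)e^{2\pi i f\tau}\,df$, and let $\sigma_X^2=\int_{\mathbb R}S_X(f)\,df$. Let $Z(\cdot)$ be the output of the linear time-invariant filter with measurable transfer function $H:\mathbb R\to\mathbb C$ and input $X(\cdot)$; that is, each $Z(t)$ is a mean-square limit of finite real combinations $\sum_j c_jX(s_j)$ whose frequency functions $\sum_j c_je^{2\pi i f s_j}$ converge to $H(f)e^{2\pi i f t}$ in $L^2(S_X(f)\,df)$. Let $f_s>0$ and $$\hat Y[n]=Z(n/f_s)+\eta[n],\qquad n\in\mathbb Z,$$ where $\eta[\cdot]$ is zero-mean white noise of variance $\sigma_\eta^2>0$, uncorrelated with $X(\cdot)$. Consider the linear reconstructions $\hat X(t)=\sum_{n\in\mathbb Z}w(t,n)\hat Y[n]$ with $w(t,\cdot)$ square summable for every $t\in\mathbb R$, the sum being the mean-square limit of some sequence of finite sums $\sum_n c_k[n]\hat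 Y[n]$ with $c_k\to w(t,\cdot)$ in $\ell^2(\mathbb Z)$. Then the minimum of $$\lim_{T\to\infty}\frac1{2T}\int_{-T}^{T}\mathbb E\bigl(X(t)-\hat X(t)\bigr)^2\,dt$$ over all such reconstructions for which the integrals and the limit exist is attained and equals $$\sigma_X^2-\int_{-f_s/2}^{f_s/2}\frac{\sum_{k\in\mathbb Z}S_X^2(f-f_sk)\,|H(f-f_sk)|^2}{\sum_{k\in\mathbb Z}S_X(f-f_sk)\,|H(f-f_sk)|^2+\sigma_\eta^2/f_s}\,df,$$ where both series converge for almost every $f$ and the integrand is integrable. The same value is the infimum when the sums are required to converge in mean square as ordinary series, i.e. along their symmetric partial sums. -/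

import Mathlib

open MeasureTheory ProbabilityTheory Filter Topology
open scoped ENNReal

noncomputable section

/-- `X` is a real, zero-mean, (wide-sense) stationary finite-variance process with power spectral
density `S`: `S` is nonnegative and integrable, and the autocorrelation is its inverse Fourier
transform, `E[X(t+τ) X(t)] = ∫ S(f) e^{2πifτ} df`. In particular `E[X(t)²] = ∫ S(f) df`. -/
structure IsStationaryWithPSD {Ω : Type*} [MeasurableSpace Ω] (P : Measure Ω)
    (X : ℝ → Ω → ℝ) (S : ℝ → ℝ) : Prop where
  memLp : ∀ t, MemLp (X t) 2 P
  mean_zero : ∀ t, ∫ ω, X t ω ∂P = 0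
  psd_nonneg : ∀ f, 0 ≤ S f
  psd_integrable : Integrable S
  autocorrelation : ∀ t τ : ℝ, ((∫ ω, X (t + τ) ω * X t ω ∂P : ℝ) : ℂ) =
    ∫ f : ℝ, (S f : ℂ) * Complex.exp (2 * Real.pi * Complex.I * f * τ)

/-- `Z` is the output of the linear time-invariant filter with transfer function `H` when the input
is the stationary process `X` with power spectral density `S`. The elementary filters are the
finite combinations of time shifts: the response `∑ c(s) X(s)` at a fixed time belongs to the
frequency function `∑ c(s) e^{2πifs}`. `Z(t)` is the mean-square limit of such responses
whose frequency functions converge to `H(f) e^{2πift}` in `L²(S(f) df)`. (A convolution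
`Z(t) = ∫ h(u) X(t-u) du` has the frequency function `H(f) e^{2πift}` with
`H(f) = ∫ h(u) e^{-2πifu} du`; the present form also includes ideal filters such as
`H = 1_{|f| ≤ B}`.) -/
structure IsFilterOutput {Ω : Type*} [MeasurableSpace Ω] (P : Measure Ω)
    (X : ℝ → Ω → ℝ) (S : ℝ → ℝ) (H : ℝ → ℂ) (Z : ℝ → Ω → ℝ) : Prop where
  memLp : ∀ t, MemLp (Z t) 2 P
  approx : ∀ t : ℝ, ∀ ε : ℝ≥0∞, 0 < ε → ∃ c : ℝ →₀ ℝ,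
    eLpNorm (fun ω => Z t ω - ∑ s ∈ c.support, c s * X s ω) 2 P < ε ∧
    ∫⁻ f : ℝ, ‖H f * Complex.exp (2 * Real.pi * Complex.I * f * t) -
      ∑ s ∈ c.support, (c s : ℂ) * Complex.exp (2 * Real.pi * Complex.I * f * s)‖ₑ ^ 2 *
        ENNReal.ofReal (S f) < ε

/-- `η` is a zero-mean white noise with variance `v`, uncorrelated with the process `X`. -/
structure IsWhiteNoise {Ω : Type*} [MeasurableSpace Ω] (P : Measure Ω)
    (X : ℝ → Ω → ℝ) (η : ℤ → Ω → ℝ) (v : ℝ) : Prop where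
  memLp : ∀ n, MemLp (η n) 2 P
  mean_zero : ∀ n, ∫ ω, η n ω ∂P = 0
  variance_eq : ∀ n, Var[η n; P] = v
  uncorrelated : ∀ m n, m ≠ n → cov[η m, η n; P] = 0
  uncorrelated_source : ∀ n t, cov[η n, X t; P] = 0

/-- The quantized samples `Ŷ[n] = Z(n / f_s) + η[n]`. -/
def quantizedSamples {Ω : Type*} (fs : ℝ) (Z : ℝ → Ω → ℝ) (η : ℤ → Ω → ℝ) : ℤ → Ω → ℝ :=
  fun n ω => Z (n / fs) ω + η n ω

/-- `V = ∑ w[n] Y[n]` with square-summable `w`, the symmetric partial sums converging in mean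
square. -/
def IsSeriesSum {Ω : Type*} [MeasurableSpace Ω] (P : Measure Ω)
    (Y : ℤ → Ω → ℝ) (w : ℤ → ℝ) (V : Ω → ℝ) : Prop :=
  Summable (fun n => w n ^ 2) ∧ MemLp V 2 P ∧
    Tendsto (fun N : ℕ => eLpNorm (fun ω => V ω - ∑ n ∈ Finset.Icc (-(N : ℤ)) N, w n * Y n ω) 2 P)
      atTop (𝓝 0)

/-- `V = ∑ w[n] Y[n]` with square-summable `w`, where the sum is the mean-square limit of
finite sums `∑ c_k[n] Y[n]` whose coefficient sequences `c_k` converge to `w` in `ℓ²`. -/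
def IsL2Sum {Ω : Type*} [MeasurableSpace Ω] (P : Measure Ω)
    (Y : ℤ → Ω → ℝ) (w : ℤ → ℝ) (V : Ω → ℝ) : Prop :=
  Summable (fun n => w n ^ 2) ∧ MemLp V 2 P ∧ ∃ c : ℕ → (ℤ →₀ ℝ),
    Tendsto (fun k => ∑' n : ℤ, (c k n - w n) ^ 2) atTop (𝓝 0) ∧
    Tendsto (fun k => eLpNorm (fun ω => V ω - ∑ n ∈ (c k).support, c k n * Y n ω) 2 P)
      atTop (𝓝 0)

/-- The reconstruction error `E (X(t) - X̂(t))²` at time `t`. -/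
def meanSquaredError {Ω : Type*} [MeasurableSpace Ω] (P : Measure Ω)
    (X Xhat : ℝ → Ω → ℝ) (t : ℝ) : ℝ :=
  ∫ ω, (X t ω - Xhat t ω) ^ 2 ∂P

/-- The values of `lim_{T → ∞} (1 / 2T) ∫_{-T}^{T} E (X(t) - X̂(t))² dt` over all the
reconstructions `X̂(t) = ∑ w(t,n) Y[n]` for which the integrals and the limit exist. The sum is
read through `IsSum` (below: `IsSeriesSum P Y` or `IsL2Sum P Y`). -/
def linearMSEs {Ω : Type*} [MeasurableSpace Ω] (P : Measure Ω) (X : ℝ → Ω → ℝ)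
    (IsSum : (ℤ → ℝ) → (Ω → ℝ) → Prop) : Set ℝ :=
  {D | ∃ (w : ℝ → ℤ → ℝ) (Xhat : ℝ → Ω → ℝ),
    (∀ t, IsSum (w t) (Xhat t)) ∧
    (∀ T : ℝ, IntervalIntegrable (meanSquaredError P X Xhat) volume (-T) T) ∧
    Tendsto (fun T : ℝ => 1 / (2 * T) * ∫ t in (-T)..T, meanSquaredError P X Xhat t)
      atTop (𝓝 D)}

/-- The `f_s`-aliased sum `∑_k g(f - f_s k)`. -/
def aliasedSum (fs : ℝ) (g : ℝ → ℝ) (f : ℝ) : ℝ :=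
  ∑' k : ℤ, g (f - fs * k)

/-- `(∑_k S²|H|²(f - f_s k)) / (∑_k S|H|²(f - f_s k) + v / f_s)`. -/
def mmseIntegrand (fs v : ℝ) (S : ℝ → ℝ) (H : ℝ → ℂ) (f : ℝ) : ℝ :=
  aliasedSum fs (fun g => S g ^ 2 * ‖H g‖ ^ 2) f /
    (aliasedSum fs (fun g => S g * ‖H g‖ ^ 2) f + v / fs)

end

/-!
The map `X(t) ↦ e^{2πift}` preserves inner products from `L²(P)` to `L²(S(f) df)`, by the formula
for the autocorrelation, so it extends to the closed real span of the process; the filter output `Z(t)`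
lies in that span and corresponds to `H(f) e^{2πift}`. Together with the orthogonality of the noise,
this turns the error of a reconstruction by finitely many samples, with coefficients `c n`, into
`∫ S |e_t - C H|² + σ² ∑ |c n|²`, where `C(f) = ∑ c n e^{2πifn/f_s}` has period `f_s`
(`norm_vec_sub_sum_sq`).

Folding the integral onto one period and completing the square at each frequency
(`spectralCost_eq`) splits this error into the residual variance `∫ S - ∫ |G_t|² / W` and a weighted
`L²` distance from `C` to `G_t / W`. Here `G_t = ∑_k S conj(H) e_t (f - f_s k)` is the folded cross
spectrum and `W = ∑_k S |H|² (f - f_s k) + σ² / f_s`. Trigonometric polynomials are dense in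
`L²(W df)`, so the residual variance is the infimum over complex coefficients
(`exists_spectralCost_lt`). Real coefficients do as well: all the inner products involved are real,
so that dropping the imaginary parts of the coefficients cannot increase the error
(`spectralCost_re_le`). Hence the residual variance at time `t` is the squared distance from `X(t)`
to the span of the samples (`infDist_vec_sq`).

As a function of `t`, the residual variance is continuous with period `1 / f_s`, so its time
averages converge to its mean over a period. By Parseval's identity in `t` that mean replaces `|G_t|²` by
`∑_k S² |H|² (f - f_s k)` (`integral_explainedVariance`), which is the stated value, and every
reconstruction has at least this error. Among `ℓ²` sums it is attained by the orthogonal projections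
of the `X(t)` onto the closed span of the samples; these are `ℓ²` sums because the noise bounds the
`ℓ²` norm of the coefficients by the norm of the sum (`exists_isL2Sum_of_mem_closure`). The
projection need not be the sum of its series along symmetric partial sums, so for series the value
is reached by finite sums, chosen measurably in `t`, whose excess error at time `t` is at most
`(1 + t²)⁻¹` and hence vanishes in the time average.
-/

noncomputable section

/-! ### Correlation-preserving pairs -/

/-- An equality of inner products on a set of pairs passes to the closed real span. -/
theorem inner_eq_of_mem_closure_span {E F : Type*}
    [NormedAddCommGroup E] [InnerProductSpace ℝ E]
    [NormedAddCommGroup F] [InnerProductSpace ℂ F]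
    [Module ℝ F] [IsScalarTower ℝ ℂ F] [ContinuousConstSMul ℝ F] {G : Set (E × F)}
    (hG : ∀ p ∈ G, ∀ q ∈ G, ((inner ℝ p.1 q.1 : ℝ) : ℂ) = inner ℂ p.2 q.2)
    {p q : E × F} (hp : p ∈ (Submodule.span ℝ G).topologicalClosure)
    (hq : q ∈ (Submodule.span ℝ G).topologicalClosure) :
    ((inner ℝ p.1 q.1 : ℝ) : ℂ) = inner ℂ p.2 q.2 := by
  have key : ∀ p ∈ Submodule.span ℝ G, ∀ q ∈ Submodule.span ℝ G,
      ((inner ℝ p.1 q.1 : ℝ) : ℂ) = inner ℂ p.2 q.2 := by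
    intro p hp q hq
    induction hp, hq using Submodule.span_induction₂ with
    | mem_mem x y hx hy => exact hG x hx y hy
    | zero_left => simp
    | zero_right => simp
    | add_left x y z hx hy hz h1 h2 =>
      simp only [Prod.fst_add, Prod.snd_add, inner_add_left, Complex.ofReal_add, h1, h2]
    | add_right x y z hx hy hz h1 h2 =>
      simp only [Prod.fst_add, Prod.snd_add, inner_add_right, Complex.ofReal_add, h1, h2]
    | smul_left r x y hx hy h =>
      have : r • x.2 = (r : ℂ) • x.2 := (algebraMap_smul ℂ r x.2).symm
      simp only [Prod.smul_fst, Prod.smul_snd, this, inner_smul_left, Complex.ofReal_mul, h,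
        Complex.conj_ofReal, conj_trivial]
    | smul_right r x y hx hy h =>
      have : r • y.2 = (r : ℂ) • y.2 := (algebraMap_smul ℂ r y.2).symm
      simp only [Prod.smul_fst, Prod.smul_snd, this, inner_smul_right, Complex.ofReal_mul, h]
  let C : Set ((E × F) × (E × F)) :=
    {r | ((inner ℝ r.1.1 r.2.1 : ℝ) : ℂ) = inner ℂ r.1.2 r.2.2}
  have hC : IsClosed C := isClosed_eq (by fun_prop) (by fun_prop)
  have hsub : (Submodule.span ℝ G : Set (E × F)) ×ˢ (Submodule.span ℝ G : Set (E × F)) ⊆ C :=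
    fun r hr => key _ hr.1 _ hr.2
  have := hC.closure_subset_iff.2 hsub
  rw [closure_prod_eq] at this
  exact this (Set.mk_mem_prod (a := p) (b := q) hp hq)

theorem norm_eq_of_inner_eq {E F : Type*}
    [NormedAddCommGroup E] [InnerProductSpace ℝ E]
    [NormedAddCommGroup F] [InnerProductSpace ℂ F] {x : E} {u : F}
    (h : ((inner ℝ x x : ℝ) : ℂ) = inner ℂ u u) : ‖x‖ ^ 2 = ‖u‖ ^ 2 := by
  rw [real_inner_self_eq_norm_sq, inner_self_eq_norm_sq_to_K] at h
  exact Complex.ofReal_injective (by simpa using h)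

/-- If `⟪u, v⟫` is real, then subtracting `i v` from `u` cannot decrease the norm. -/
theorem norm_sq_le_norm_sub_I_smul {F : Type*} [NormedAddCommGroup F] [InnerProductSpace ℂ F]
    {u v : F} (h : (inner ℂ u v : ℂ).im = 0) : ‖u‖ ^ 2 ≤ ‖u - Complex.I • v‖ ^ 2 := by
  have := norm_sub_sq (𝕜 := ℂ) u (Complex.I • v)
  rw [this, inner_smul_right]
  have : RCLike.re (Complex.I * (inner ℂ u v : ℂ)) = 0 := by
    simp [h]
  rw [this]
  nlinarith [sq_nonneg ‖Complex.I • v‖]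

/-! ### Spectral representation -/

/-- The finite measure `S(f) df`. -/
def psdMeasure (S : ℝ → ℝ) : Measure ℝ := volume.withDensity fun f => ENNReal.ofReal (S f)

/-- The frequency function `f ↦ e^{2πift}` of the time shift by `t`. -/
def osc (t f : ℝ) : ℂ := Complex.exp (2 * Real.pi * Complex.I * f * t)

theorem continuous_osc_uncurry : Continuous (fun p : ℝ × ℝ => osc p.1 p.2) := by
  unfold osc; fun_prop

theorem continuous_osc (t : ℝ) : Continuous (osc t) := by
  unfold osc; fun_prop

theorem osc_eq_exp_mul_I (t f : ℝ) :
    osc t f = Complex.exp (((2 * Real.pi * f * t : ℝ) : ℂ) * Complex.I) := by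
  unfold osc; congr 1; push_cast; ring

@[simp] theorem norm_osc (t f : ℝ) : ‖osc t f‖ = 1 := by
  rw [osc_eq_exp_mul_I, Complex.norm_exp_ofReal_mul_I]

theorem osc_add (s t f : ℝ) : osc (s + t) f = osc s f * osc t f := by
  unfold osc; rw [← Complex.exp_add]; congr 1; push_cast; ring

theorem conj_osc (t f : ℝ) : (starRingEnd ℂ) (osc t f) = osc (-t) f := by
  unfold osc; rw [← Complex.exp_conj]; congr 1
  simp [map_ofNat]

theorem aemeasurable_psdMeasure_density {S : ℝ → ℝ} (hS : Integrable S) :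
    AEMeasurable (fun f => ENNReal.ofReal (S f)) volume :=
  hS.aestronglyMeasurable.aemeasurable.ennreal_ofReal

theorem isFiniteMeasure_psdMeasure {S : ℝ → ℝ} (hS : Integrable S) :
    IsFiniteMeasure (psdMeasure S) :=
  isFiniteMeasure_withDensity_ofReal hS.2

theorem integral_psdMeasure {E : Type*} [NormedAddCommGroup E] [NormedSpace ℝ E]
    {S : ℝ → ℝ} (hS : Integrable S) (hS0 : ∀ f, 0 ≤ S f)
    (g : ℝ → E) : ∫ f, g f ∂psdMeasure S = ∫ f, S f • g f := by
  rw [psdMeasure, integral_withDensity_eq_integral_toReal_smul₀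
    (aemeasurable_psdMeasure_density hS) (by simp)]
  simp only [ENNReal.toReal_ofReal (hS0 _)]

theorem integrable_psdMeasure_iff {E : Type*} [NormedAddCommGroup E] [NormedSpace ℝ E]
    {S : ℝ → ℝ} (hS : Integrable S) (hS0 : ∀ f, 0 ≤ S f)
    (g : ℝ → E) : Integrable g (psdMeasure S) ↔ Integrable fun f => S f • g f := by
  rw [psdMeasure, integrable_withDensity_iff_integrable_smul₀'
    (aemeasurable_psdMeasure_density hS) (by simp)]
  simp only [ENNReal.toReal_ofReal (hS0 _)]

theorem psdMeasure_absolutelyContinuous (S : ℝ → ℝ) : psdMeasure S ≪ volume :=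
  withDensity_absolutelyContinuous _ _

theorem memLp_osc {S : ℝ → ℝ} (hS : Integrable S) (t : ℝ) : MemLp (osc t) 2 (psdMeasure S) := by
  have := isFiniteMeasure_psdMeasure hS
  exact MemLp.of_bound (continuous_osc t).aestronglyMeasurable 1 (by simp)

theorem eLpNorm_two_sq_psdMeasure {S : ℝ → ℝ} (hS : Integrable S) (g : ℝ → ℂ) :
    eLpNorm g 2 (psdMeasure S) ^ 2 = ∫⁻ f, ‖g f‖ₑ ^ 2 * ENNReal.ofReal (S f) := by
  rw [eLpNorm_eq_lintegral_rpow_enorm_toReal (by norm_num) (by norm_num), psdMeasure]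
  rw [← ENNReal.rpow_natCast, ← ENNReal.rpow_mul]
  norm_num
  rw [lintegral_withDensity_eq_lintegral_mul_non_measurable₀ _
    (aemeasurable_psdMeasure_density hS) (by simp)]
  simp [mul_comm]

theorem MeasureTheory.MemLp.coeFn_finset_sum_smul_toLp {α ι 𝕜 : Type*} [RCLike 𝕜]
    [MeasurableSpace α] {μ : Measure α} {p : ℝ≥0∞} {f : ι → α → 𝕜}
    (hf : ∀ i, MemLp (f i) p μ) (s : Finset ι) (c : ι → 𝕜) :
    ⇑(∑ i ∈ s, c i • (hf i).toLp) =ᵐ[μ] fun a => ∑ i ∈ s, c i * f i a := by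
  refine (Lp.coeFn_finsetSum s _).trans ?_
  have : ∀ i ∈ s, ∀ᵐ a ∂μ, (c i • (hf i).toLp : Lp 𝕜 p μ) a = c i * f i a := by
    intro i _
    filter_upwards [Lp.coeFn_smul (c i) (hf i).toLp, (hf i).coeFn_toLp] with a h1 h2
    rw [h1, Pi.smul_apply, h2, smul_eq_mul]
  filter_upwards [(Filter.eventually_all_finset s).2 this] with a ha
  rw [Finset.sum_apply]
  exact Finset.sum_congr rfl ha

theorem norm_toLp_two_sq {α 𝕜 : Type*} [RCLike 𝕜] [MeasurableSpace α] {μ : Measure α}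
    {f : α → 𝕜} {g : Lp 𝕜 2 μ} (h : g =ᵐ[μ] f) : ‖g‖ ^ 2 = ∫ a, ‖f a‖ ^ 2 ∂μ := by
  have h1 : ((‖g‖ ^ 2 : ℝ) : 𝕜) = inner 𝕜 g g := by
    rw [inner_self_eq_norm_sq_to_K]; push_cast; rfl
  have h2 : (inner 𝕜 g g : 𝕜) = ((∫ a, ‖f a‖ ^ 2 ∂μ : ℝ) : 𝕜) := by
    rw [L2.inner_def, ← integral_ofReal]
    refine integral_congr_ae ?_
    filter_upwards [h] with a ha
    rw [ha, inner_self_eq_norm_sq_to_K]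
    push_cast; rfl
  exact RCLike.ofReal_injective (h1.trans h2)

section Spectral

variable {Ω : Type*} [MeasurableSpace Ω] {P : Measure Ω} {X Z : ℝ → Ω → ℝ} {S : ℝ → ℝ} {H : ℝ → ℂ}
  {η : ℤ → Ω → ℝ} {v : ℝ}

/-- `X(t)` as a vector of `L²(P)`. -/
def IsStationaryWithPSD.vec (hX : IsStationaryWithPSD P X S) (t : ℝ) : Lp ℝ 2 P :=
  (hX.memLp t).toLp

/-- The frequency function of the time shift by `t` as a vector of `L²(S(f) df)`. -/
def IsStationaryWithPSD.freq (hX : IsStationaryWithPSD P X S) (t : ℝ) : Lp ℂ 2 (psdMeasure S) :=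
  (memLp_osc hX.psd_integrable t).toLp

theorem IsStationaryWithPSD.inner_vec_eq_inner_freq (hX : IsStationaryWithPSD P X S) (s t : ℝ) :
    ((inner ℝ (hX.vec s) (hX.vec t) : ℝ) : ℂ) = inner ℂ (hX.freq s) (hX.freq t) := by
  rw [L2.inner_def, L2.inner_def]
  have h1 : ∫ a, (inner ℝ (hX.vec s a) (hX.vec t a) : ℝ) ∂P
      = ∫ ω, X (s + (t - s)) ω * X s ω ∂P := by
    refine integral_congr_ae ?_
    filter_upwards [(hX.memLp s).coeFn_toLp, (hX.memLp t).coeFn_toLp] with ω h1 h2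
    simp only [IsStationaryWithPSD.vec, h1, h2, add_sub_cancel]
    simp
  have h2 : ∫ a, (inner ℂ (hX.freq s a) (hX.freq t a) : ℂ) ∂psdMeasure S
      = ∫ f, osc (t - s) f ∂psdMeasure S := by
    refine integral_congr_ae ?_
    filter_upwards [(memLp_osc hX.psd_integrable s).coeFn_toLp,
      (memLp_osc hX.psd_integrable t).coeFn_toLp] with f h1 h2
    simp only [IsStationaryWithPSD.freq, h1, h2]
    rw [RCLike.inner_apply, conj_osc, ← osc_add, sub_eq_add_neg]
  rw [h1, h2, hX.autocorrelation, integral_psdMeasure hX.psd_integrable hX.psd_nonneg]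
  rfl

/-- The closed real subspace of `L²(P) × L²(S(f) df)` of the pairs consisting of a (limit of) linear
combinations of the `X(t)` and its frequency function. -/
def IsStationaryWithPSD.spectralPairs (hX : IsStationaryWithPSD P X S) :
    Submodule ℝ (Lp ℝ 2 P × Lp ℂ 2 (psdMeasure S)) :=
  (Submodule.span ℝ (Set.range fun t => (hX.vec t, hX.freq t))).topologicalClosure

theorem IsStationaryWithPSD.inner_eq_of_mem (hX : IsStationaryWithPSD P X S)
    {p q : Lp ℝ 2 P × Lp ℂ 2 (psdMeasure S)} (hp : p ∈ hX.spectralPairs)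
    (hq : q ∈ hX.spectralPairs) : ((inner ℝ p.1 q.1 : ℝ) : ℂ) = inner ℂ p.2 q.2 := by
  refine inner_eq_of_mem_closure_span ?_ hp hq
  rintro _ ⟨s, rfl⟩ _ ⟨t, rfl⟩
  exact hX.inner_vec_eq_inner_freq s t

theorem IsStationaryWithPSD.vec_mem (hX : IsStationaryWithPSD P X S) (t : ℝ) :
    (hX.vec t, hX.freq t) ∈ hX.spectralPairs :=
  Submodule.le_topologicalClosure _ (Submodule.subset_span ⟨t, rfl⟩)

theorem IsFilterOutput.memLp_freq (hX : IsStationaryWithPSD P X S)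
    (hH : AEStronglyMeasurable H volume) (hZ : IsFilterOutput P X S H Z) (t : ℝ) :
    MemLp (fun f => H f * osc t f) 2 (psdMeasure S) := by
  obtain ⟨c, -, hc⟩ := hZ.approx t 1 one_pos
  have h1 : MemLp (fun f => ∑ s ∈ c.support, (c s : ℂ) * osc s f) 2 (psdMeasure S) :=
    memLp_finsetSum _ fun s _ => (memLp_osc hX.psd_integrable s).const_mul _
  have h2 : MemLp (fun f => H f * osc t f - ∑ s ∈ c.support, (c s : ℂ) * osc s f) 2
      (psdMeasure S) := by
    refine ⟨((hH.mono_ac (psdMeasure_absolutelyContinuous S)).mul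
      (continuous_osc t).aestronglyMeasurable).sub h1.1, ?_⟩
    have := eLpNorm_two_sq_psdMeasure hX.psd_integrable
      (fun f => H f * osc t f - ∑ s ∈ c.support, (c s : ℂ) * osc s f)
    by_contra hcon
    rw [not_lt, top_le_iff] at hcon
    rw [hcon] at this
    have h3 : (∞ : ℝ≥0∞) ^ 2 < 1 := this ▸ hc
    simp at h3
  convert h2.add h1 using 1
  ext f
  simp

/-- The filter output corresponds to the frequency function `H(f) e^{2πift}`. -/
theorem IsFilterOutput.mem_spectralPairs (hX : IsStationaryWithPSD P X S)
    (hH : AEStronglyMeasurable H volume) (hZ : IsFilterOutput P X S H Z) (t : ℝ) :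
    ((hZ.memLp t).toLp, (hZ.memLp_freq hX hH t).toLp) ∈ hX.spectralPairs := by
  change _ ∈ closure _
  rw [EMetric.mem_closure_iff]
  intro ε hε
  obtain ⟨c, hc1, hc2⟩ := hZ.approx t (min ε (ε ^ 2)) (lt_min hε (by positivity))
  refine ⟨(∑ s ∈ c.support, c s • hX.vec s, ∑ s ∈ c.support, (c s : ℂ) • hX.freq s), ?_, ?_⟩
  · have : (∑ s ∈ c.support, c s • hX.vec s, ∑ s ∈ c.support, (c s : ℂ) • hX.freq s)
        = ∑ s ∈ c.support, c s • (hX.vec s, hX.freq s) := by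
      refine Prod.ext ?_ ?_
      · simp [Prod.fst_sum]
      · simp only [Prod.snd_sum, Prod.smul_snd]
        exact Finset.sum_congr rfl fun s _ => algebraMap_smul ℂ (c s) (hX.freq s)
    rw [this]
    exact Submodule.sum_mem _ fun s _ => Submodule.smul_mem _ _ (Submodule.subset_span ⟨s, rfl⟩)
  · rw [Prod.edist_eq, max_lt_iff]
    constructor
    · rw [Lp.edist_def]
      refine lt_of_le_of_lt (le_of_eq (eLpNorm_congr_ae ?_)) (hc1.trans_le (min_le_left _ _))
      filter_upwards [(hZ.memLp t).coeFn_toLp,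
        MemLp.coeFn_finset_sum_smul_toLp hX.memLp c.support c] with ω h1 h2
      exact congrArg₂ (· - ·) h1 h2
    · have h3 := eLpNorm_two_sq_psdMeasure hX.psd_integrable
        (fun f => H f * osc t f - ∑ s ∈ c.support, (c s : ℂ) * osc s f)
      rw [Lp.edist_def]
      have h4 : eLpNorm (fun f => H f * osc t f - ∑ s ∈ c.support, (c s : ℂ) * osc s f) 2
          (psdMeasure S) < ε := by
        refine (ENNReal.pow_lt_pow_left_iff two_ne_zero).1 ?_
        rw [h3]
        exact hc2.trans_le (min_le_right _ _)
      refine lt_of_le_of_lt (le_of_eq (eLpNorm_congr_ae ?_)) h4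
      filter_upwards [(hZ.memLp_freq hX hH t).coeFn_toLp,
        MemLp.coeFn_finset_sum_smul_toLp (memLp_osc hX.psd_integrable) c.support
          (fun s => (c s : ℂ))] with ω h1 h2
      exact congrArg₂ (· - ·) h1 h2

/-! ### The noisy samples -/

theorem IsWhiteNoise.inner_toLp (hv : IsWhiteNoise P X η v) [IsProbabilityMeasure P] (m n : ℤ) :
    inner ℝ ((hv.memLp m).toLp) ((hv.memLp n).toLp) = if m = n then v else 0 := by
  have h1 : inner ℝ ((hv.memLp m).toLp) ((hv.memLp n).toLp) = cov[η m, η n; P] := by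
    rw [L2.inner_def, covariance, hv.mean_zero, hv.mean_zero]
    refine integral_congr_ae ?_
    filter_upwards [(hv.memLp m).coeFn_toLp, (hv.memLp n).coeFn_toLp] with ω h1 h2
    rw [h1, h2]
    simp [mul_comm]
  rw [h1]
  split_ifs with h
  · rw [h, covariance_self (hv.memLp n).1.aemeasurable, hv.variance_eq]
  · exact hv.uncorrelated m n h

theorem IsWhiteNoise.inner_toLp_eq_zero (hX : IsStationaryWithPSD P X S)
    (hv : IsWhiteNoise P X η v) (n : ℤ)
    {p : Lp ℝ 2 P × Lp ℂ 2 (psdMeasure S)} (hp : p ∈ hX.spectralPairs) :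
    inner ℝ ((hv.memLp n).toLp) p.1 = 0 := by
  have key : ∀ t, inner ℝ ((hv.memLp n).toLp) (hX.vec t) = 0 := by
    intro t
    rw [← hv.uncorrelated_source n t, L2.inner_def, covariance, hv.mean_zero, hX.mean_zero]
    refine integral_congr_ae ?_
    filter_upwards [(hv.memLp n).coeFn_toLp, (hX.memLp t).coeFn_toLp] with ω h1 h2
    rw [h1, IsStationaryWithPSD.vec, h2]
    simp [mul_comm]
  let N : Submodule ℝ (Lp ℝ 2 P × Lp ℂ 2 (psdMeasure S)) :=
    (LinearMap.ker (innerSL ℝ ((hv.memLp n).toLp)).toLinearMap).comap (LinearMap.fst ℝ _ _)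
  have hN : IsClosed (N : Set (Lp ℝ 2 P × Lp ℂ 2 (psdMeasure S))) := by
    have : (N : Set (Lp ℝ 2 P × Lp ℂ 2 (psdMeasure S)))
        = {p | inner ℝ ((hv.memLp n).toLp) p.1 = 0} := by
      ext p; simp [N]
    rw [this]
    exact isClosed_eq (by fun_prop) continuous_const
  have hle : hX.spectralPairs ≤ N := by
    refine Submodule.topologicalClosure_minimal _ (Submodule.span_le.2 ?_) hN
    rintro _ ⟨t, rfl⟩
    simp [N, key t]
  simpa [N] using hle hp

/-- Pythagoras: the noise is orthogonal to everything that the process spans. -/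
theorem IsWhiteNoise.norm_sub_sum_sq [IsProbabilityMeasure P] (hX : IsStationaryWithPSD P X S)
    (hv : IsWhiteNoise P X η v)
    {p : Lp ℝ 2 P × Lp ℂ 2 (psdMeasure S)} (hp : p ∈ hX.spectralPairs) (s : Finset ℤ)
    (c : ℤ → ℝ) :
    ‖p.1 - ∑ n ∈ s, c n • (hv.memLp n).toLp‖ ^ 2 = ‖p.2‖ ^ 2 + v * ∑ n ∈ s, c n ^ 2 := by
  have h1 : inner ℝ p.1 (∑ n ∈ s, c n • (hv.memLp n).toLp) = 0 := by
    rw [inner_sum]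
    refine Finset.sum_eq_zero fun n _ => ?_
    rw [inner_smul_right, real_inner_comm, hv.inner_toLp_eq_zero hX n hp, mul_zero]
  have h2 : ‖∑ n ∈ s, c n • (hv.memLp n).toLp‖ ^ 2 = v * ∑ n ∈ s, c n ^ 2 := by
    rw [← real_inner_self_eq_norm_sq, sum_inner, Finset.mul_sum]
    refine Finset.sum_congr rfl fun m hm => ?_
    rw [inner_sum, Finset.sum_eq_single m]
    · rw [inner_smul_left, inner_smul_right, hv.inner_toLp, if_pos rfl]
      simp; ring
    · intro n _ hn
      rw [inner_smul_left, inner_smul_right, hv.inner_toLp, if_neg hn.symm]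
      simp
    · exact fun h => absurd hm h
  rw [norm_sub_sq_real, h1, h2, norm_eq_of_inner_eq (hX.inner_eq_of_mem hp hp)]
  ring

/-- The trigonometric polynomial `∑ c(n) e^{2πifn/f_s}` of period `f_s`. -/
def trigPoly (fs : ℝ) (s : Finset ℤ) (c : ℤ → ℂ) (f : ℝ) : ℂ :=
  ∑ n ∈ s, c n * osc (n / fs) f

/-- The mean squared error at time `t` of the reconstruction with the finitely many coefficients
`c n`, `n ∈ s`, written in the frequency domain; complex coefficients are allowed. -/
def spectralCost (S : ℝ → ℝ) (H : ℝ → ℂ) (fs v t : ℝ) (s : Finset ℤ) (c : ℤ → ℂ) : ℝ :=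
  (∫ f, S f * ‖osc t f - trigPoly fs s c f * H f‖ ^ 2) + v * ∑ n ∈ s, ‖c n‖ ^ 2

theorem IsFilterOutput.sum_mem_spectralPairs (hX : IsStationaryWithPSD P X S)
    (hH : AEStronglyMeasurable H volume) (hZ : IsFilterOutput P X S H Z) (r : ℤ → ℝ)
    (s : Finset ℤ) (c : ℤ → ℝ) :
    (∑ n ∈ s, c n • (hZ.memLp (r n)).toLp,
      ∑ n ∈ s, (c n : ℂ) • (hZ.memLp_freq hX hH (r n)).toLp) ∈ hX.spectralPairs := by
  have : (∑ n ∈ s, c n • (hZ.memLp (r n)).toLp,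
      ∑ n ∈ s, (c n : ℂ) • (hZ.memLp_freq hX hH (r n)).toLp)
      = ∑ n ∈ s, c n • ((hZ.memLp (r n)).toLp, (hZ.memLp_freq hX hH (r n)).toLp) := by
    refine Prod.ext ?_ ?_
    · simp [Prod.fst_sum]
    · simp only [Prod.snd_sum, Prod.smul_snd]
      exact Finset.sum_congr rfl fun n _ => algebraMap_smul ℂ (c n) (_ : Lp ℂ 2 (psdMeasure S))
  rw [this]
  exact Submodule.sum_mem _ fun n _ => Submodule.smul_mem _ _ (hZ.mem_spectralPairs hX hH _)

theorem norm_freq_sub_sum_sq (hX : IsStationaryWithPSD P X S)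
    (hH : AEStronglyMeasurable H volume) (hZ : IsFilterOutput P X S H Z)
    (fs t : ℝ) (s : Finset ℤ) (c : ℤ → ℂ) :
    ‖hX.freq t - ∑ n ∈ s, c n • (hZ.memLp_freq hX hH (n / fs)).toLp‖ ^ 2
      = ∫ f, S f * ‖osc t f - trigPoly fs s c f * H f‖ ^ 2 := by
  rw [norm_toLp_two_sq (f := fun f => osc t f - trigPoly fs s c f * H f),
    integral_psdMeasure hX.psd_integrable hX.psd_nonneg]
  · rfl
  · filter_upwards [Lp.coeFn_sub (hX.freq t)
        (∑ n ∈ s, c n • (hZ.memLp_freq hX hH (n / fs)).toLp),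
      (memLp_osc hX.psd_integrable t).coeFn_toLp,
      MemLp.coeFn_finset_sum_smul_toLp (fun n : ℤ => hZ.memLp_freq hX hH (n / fs)) s c]
      with f h1 h2 h3
    rw [h1, Pi.sub_apply, IsStationaryWithPSD.freq, h2, h3, trigPoly, Finset.sum_mul]
    congr 1
    exact Finset.sum_congr rfl fun n _ => by ring

/-- Real coefficients suffice, because `⟪e_t, H e_n⟫` and `⟪H e_m, H e_n⟫` are covariances of the
real processes `X` and `Z`, hence real. -/
theorem spectralCost_re_le (hX : IsStationaryWithPSD P X S)
    (hH : AEStronglyMeasurable H volume) (hZ : IsFilterOutput P X S H Z)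
    (hv : 0 ≤ v) (fs t : ℝ) (s : Finset ℤ) (c : ℤ → ℂ) :
    spectralCost S H fs v t s (fun n => ((c n).re : ℂ)) ≤ spectralCost S H fs v t s c := by
  unfold spectralCost
  rw [← norm_freq_sub_sum_sq hX hH hZ, ← norm_freq_sub_sum_sq hX hH hZ]
  set h : ℤ → Lp ℂ 2 (psdMeasure S) := fun n => (hZ.memLp_freq hX hH (n / fs)).toLp with hh
  have hsum := hZ.sum_mem_spectralPairs hX hH (fun n : ℤ => n / fs) s
  have hreal : (inner ℂ (hX.freq t - ∑ n ∈ s, ((c n).re : ℂ) • h n)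
      (∑ n ∈ s, ((c n).im : ℂ) • h n) : ℂ).im = 0 := by
    have := hX.inner_eq_of_mem (Submodule.sub_mem _ (hX.vec_mem t) (hsum fun n => (c n).re))
      (hsum fun n => (c n).im)
    rw [Prod.snd_sub] at this
    rw [← this, Complex.ofReal_im]
  have h1 := norm_sq_le_norm_sub_I_smul hreal
  have h2 : hX.freq t - ∑ n ∈ s, ((c n).re : ℂ) • h n -
      Complex.I • ∑ n ∈ s, ((c n).im : ℂ) • h n = hX.freq t - ∑ n ∈ s, c n • h n := by
    rw [sub_sub, Finset.smul_sum, ← Finset.sum_add_distrib]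
    congr 1
    refine Finset.sum_congr rfl fun n _ => ?_
    rw [smul_smul, ← add_smul, mul_comm Complex.I, Complex.re_add_im]
  rw [h2] at h1
  refine add_le_add h1 (mul_le_mul_of_nonneg_left (Finset.sum_le_sum fun n _ => ?_) hv)
  rw [Complex.norm_real, Real.norm_eq_abs]
  exact pow_le_pow_left₀ (abs_nonneg _) (Complex.abs_re_le_norm _) 2

theorem memLp_quantizedSamples (hZ : IsFilterOutput P X S H Z) (hη : IsWhiteNoise P X η v)
    (fs : ℝ) (n : ℤ) : MemLp (quantizedSamples fs Z η n) 2 P :=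
  (hZ.memLp _).add (hη.memLp n)

/-- The mean squared error of a finite reconstruction in the frequency domain. -/
theorem norm_vec_sub_sum_sq [IsProbabilityMeasure P] (hX : IsStationaryWithPSD P X S)
    (hH : AEStronglyMeasurable H volume) (hZ : IsFilterOutput P X S H Z)
    (hη : IsWhiteNoise P X η v) (fs t : ℝ) (s : Finset ℤ) (c : ℤ → ℝ) :
    ‖hX.vec t - ∑ n ∈ s, c n • (memLp_quantizedSamples hZ hη fs n).toLp‖ ^ 2
      = spectralCost S H fs v t s (fun n => (c n : ℂ)) := by
  have hy : ∀ n, (memLp_quantizedSamples hZ hη fs n).toLp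
      = (hZ.memLp (n / fs)).toLp + (hη.memLp n).toLp := fun n => MemLp.toLp_add _ _
  have hmem := Submodule.sub_mem _ (hX.vec_mem t)
    (hZ.sum_mem_spectralPairs hX hH (fun n : ℤ => n / fs) s c)
  have := hη.norm_sub_sum_sq hX hmem s c
  simp only [hy, smul_add, Finset.sum_add_distrib, ← sub_sub]
  rw [Prod.fst_sub, Prod.snd_sub] at this
  rw [this, norm_freq_sub_sum_sq hX hH hZ, spectralCost]
  simp

end Spectral

/-! ### Folding the line onto one period -/

section Folding

open Set

/-- The integers as the group of translations by the multiples of `fs`; the sign makes `k` act by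
`f ↦ f - fs * k`. -/
def zmultiplesEquivInt {fs : ℝ} (hfs : 0 < fs) : ℤ ≃ AddSubgroup.zmultiples fs :=
  (Equiv.neg ℤ).trans
    (Equiv.ofInjective (fun n : ℤ => n • fs) (zsmul_left_strictMono hfs).injective)

theorem zmultiplesEquivInt_vadd {fs : ℝ} (hfs : 0 < fs) (k : ℤ) (f : ℝ) :
    (zmultiplesEquivInt hfs k) +ᵥ f = f - fs * k := by
  change (-k) • fs + f = _
  simp; ring

theorem lintegral_eq_tsum_translate {fs : ℝ} (hfs : 0 < fs) (a : ℝ) (g : ℝ → ℝ≥0∞) :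
    ∫⁻ f, g f = ∑' k : ℤ, ∫⁻ f in Ioc a (a + fs), g (f - fs * k) := by
  have h := (isAddFundamentalDomain_Ioc hfs a volume).lintegral_eq_tsum'' g
  rw [h, ← (zmultiplesEquivInt hfs).tsum_eq]
  simp only [zmultiplesEquivInt_vadd]

variable {E : Type*} [NormedAddCommGroup E]

theorem tsum_lintegral_enorm_translate_ne_top {fs : ℝ} (hfs : 0 < fs) {F : ℝ → E}
    (hF : Integrable F) (a : ℝ) :
    ∑' k : ℤ, ∫⁻ f in Ioc a (a + fs), ‖F (f - fs * k)‖ₑ ≠ ∞ := by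
  rw [← lintegral_eq_tsum_translate hfs a fun f => ‖F f‖ₑ]
  exact hF.2.ne

theorem MeasureTheory.Integrable.ae_summable_translate_restrict {fs : ℝ} (hfs : 0 < fs)
    {F : ℝ → E} (hF : Integrable F) (a : ℝ) :
    ∀ᵐ f ∂volume.restrict (Ioc a (a + fs)), Summable fun k : ℤ => ‖F (f - fs * k)‖ := by
  have hmeas : ∀ k : ℤ, AEMeasurable (fun f => ‖F (f - fs * k)‖ₑ)
      (volume.restrict (Ioc a (a + fs))) := fun k =>
    (hF.comp_sub_right (fs * k)).1.enorm.restrict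
  have h := tsum_lintegral_enorm_translate_ne_top hfs hF a
  rw [← lintegral_tsum hmeas] at h
  filter_upwards [ae_lt_top' (AEMeasurable.tsum hmeas) h] with f hf
  have := ENNReal.tsum_coe_ne_top_iff_summable.1 hf.ne
  exact NNReal.summable_coe.2 this

theorem MeasureTheory.Integrable.ae_summable_translate {fs : ℝ} (hfs : 0 < fs) {F : ℝ → E}
    (hF : Integrable F) : ∀ᵐ f : ℝ, Summable fun k : ℤ => ‖F (f - fs * k)‖ := by
  rw [← Measure.restrict_univ (μ := (volume : Measure ℝ)), ← iUnion_Ioc_add_zsmul hfs 0,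
    ae_restrict_iUnion_iff]
  intro n
  have := hF.ae_summable_translate_restrict hfs (0 + n • fs)
  rwa [add_assoc, ← add_one_zsmul] at this

theorem MeasureTheory.Integrable.integrableOn_tsum_translate [CompleteSpace E] {fs : ℝ}
    (hfs : 0 < fs) {F : ℝ → E} (hF : Integrable F) (a : ℝ) :
    IntegrableOn (fun f => ∑' k : ℤ, F (f - fs * k)) (Ioc a (a + fs)) := by
  have hmeas : ∀ k : ℤ, AEStronglyMeasurable (fun f => F (f - fs * k))
      (volume.restrict (Ioc a (a + fs))) := fun k => (hF.comp_sub_right (fs * k)).1.restrict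
  constructor
  · refine aestronglyMeasurable_of_tendsto_ae atTop
      (f := fun (s : Finset ℤ) f => ∑ k ∈ s, F (f - fs * k))
      (fun s => Finset.aestronglyMeasurable_fun_sum s fun k _ => hmeas k) ?_
    filter_upwards [hF.ae_summable_translate_restrict hfs a] with f hf
    exact hf.of_norm.hasSum
  · have h := tsum_lintegral_enorm_translate_ne_top hfs hF a
    rw [← lintegral_tsum fun k => (hmeas k).enorm] at h
    exact lt_of_le_of_lt (lintegral_mono fun f => enorm_tsum_le_tsum_enorm) h.lt_top

theorem MeasureTheory.Integrable.setIntegral_tsum_translate [NormedSpace ℝ E] [CompleteSpace E]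
    {fs : ℝ} (hfs : 0 < fs) {F : ℝ → E} (hF : Integrable F) (a : ℝ) :
    ∫ f in Ioc a (a + fs), ∑' k : ℤ, F (f - fs * k) = ∫ f, F f := by
  have h := (isAddFundamentalDomain_Ioc hfs a volume).integral_eq_tsum'' F hF
  rw [integral_tsum (fun k : ℤ => (hF.comp_sub_right (fs * k)).1.restrict)
    (tsum_lintegral_enorm_translate_ne_top hfs hF a), h, ← (zmultiplesEquivInt hfs).tsum_eq]
  simp only [zmultiplesEquivInt_vadd]

end Folding

/-! ### Fourier series -/

section FourierSeries

open Set

theorem fourier_coe_eq_osc (T : ℝ) (n : ℤ) (x : ℝ) :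
    fourier n (x : AddCircle T) = osc (n / T) x := by
  rw [fourier_coe_apply, osc]
  congr 1; push_cast; ring

/-- Parseval's identity for an absolutely convergent Fourier series. -/
theorem setIntegral_norm_sq_tsum_osc {T : ℝ} (hT : 0 < T) (a : ℝ) {c : ℤ → ℂ}
    (hc : Summable fun n => ‖c n‖) :
    ∫ x in Ioc a (a + T), ‖∑' n : ℤ, c n * osc (n / T) x‖ ^ 2 = T * ∑' n, ‖c n‖ ^ 2 := by
  have : Fact (0 < T) := ⟨hT⟩
  have hs : Summable fun n => c n • (fourier n : C(AddCircle T, ℂ)) :=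
    Summable.of_norm (by simpa [norm_smul, fourier_norm] using hc)
  set φ : C(AddCircle T, ℂ) := ∑' n, c n • (fourier n : C(AddCircle T, ℂ)) with hφ
  have hcoe : ∀ x : ℝ, φ x = ∑' n : ℤ, c n * osc (n / T) x := by
    intro x
    rw [hφ, ← ContinuousMap.tsum_apply hs]
    exact tsum_congr fun n => by
      rw [ContinuousMap.smul_apply, fourier_coe_eq_osc, smul_eq_mul]
  have hcoeff : ∀ n, fourierCoeff φ n = c n := by
    intro n
    have h1 : HasSum (fun m => c m • fourierLp (T := T) 2 m)
        (ContinuousMap.toLp (E := ℂ) 2 AddCircle.haarAddCircle ℂ φ) := by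
      have := hs.hasSum.mapL (ContinuousMap.toLp (E := ℂ) 2 (AddCircle.haarAddCircle (T := T)) ℂ)
      simpa only [map_smul] using this
    have h2 := h1.mapL (innerSL ℂ (fourierLp (T := T) 2 n))
    have h3 : inner ℂ (fourierLp (T := T) 2 n)
        (ContinuousMap.toLp (E := ℂ) 2 AddCircle.haarAddCircle ℂ φ) = c n := by
      refine h2.unique ?_
      convert hasSum_single n ?_ using 1
      · rw [innerSL_apply_apply, inner_smul_right, orthonormal_iff_ite.1 orthonormal_fourier,
          if_pos rfl, mul_one]
      · intro m hm
        rw [innerSL_apply_apply, inner_smul_right, orthonormal_iff_ite.1 orthonormal_fourier,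
          if_neg hm.symm, mul_zero]
    rw [← h3, ContinuousMap.inner_toLp, fourierCoeff]
    refine integral_congr_ae (Eventually.of_forall fun x => ?_)
    simp only [smul_eq_mul, fourier_neg]
    exact mul_comm _ _
  have hP := hasSum_sq_fourierCoeff (ContinuousMap.toLp (E := ℂ) 2
    (AddCircle.haarAddCircle (T := T)) ℂ φ)
  have hae := ContinuousMap.coeFn_toLp (p := 2) (𝕜 := ℂ) (AddCircle.haarAddCircle (T := T)) φ
  simp only [fourierCoeff_congr_ae hae, hcoeff] at hP
  rw [hP.tsum_eq]
  have h4 : ∫ t, ‖(ContinuousMap.toLp (E := ℂ) 2 (AddCircle.haarAddCircle (T := T)) ℂ φ) t‖ ^ 2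
      ∂AddCircle.haarAddCircle = ∫ t, ‖φ t‖ ^ 2 ∂(AddCircle.haarAddCircle (T := T)) :=
    integral_congr_ae (hae.mono fun x hx => by simp only [hx])
  rw [h4, AddCircle.integral_haarAddCircle, ← AddCircle.integral_preimage T a, smul_eq_mul,
    mul_inv_cancel_left₀ hT.ne']
  simp only [hcoe]

/-- Trigonometric polynomials of period `T` are dense in `L²` of a finite measure on a period:
transported to the circle, this is the density of the Fourier monomials in the continuous functions
and of these in `L²`. -/
theorem exists_trigPoly_eLpNorm_sub_lt {T : ℝ} (hT : 0 < T) (a : ℝ) (ν : Measure ℝ)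
    [IsFiniteMeasure ν] (hν : ν (Ioc a (a + T))ᶜ = 0) {g : ℝ → ℂ} (hg : MemLp g 2 ν)
    {ε : ℝ≥0∞} (hε : 0 < ε) :
    ∃ (s : Finset ℤ) (c : ℤ → ℂ), eLpNorm (fun f => g f - trigPoly T s c f) 2 ν < ε := by
  have : Fact (0 < T) := ⟨hT⟩
  let π : ℝ → AddCircle T := fun x => (x : AddCircle T)
  have hπ : Measurable π := AddCircle.measurable_mk'
  let κ : Measure (AddCircle T) := ν.map π
  have : IsFiniteMeasure κ := Measure.isFiniteMeasure_map ν π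
  have hmem : ∀ᵐ x ∂ν, x ∈ Ioc a (a + T) := hν
  let r : AddCircle T → ℝ := fun θ => (AddCircle.equivIoc T a θ : ℝ)
  have hr : Measurable r :=
    measurable_subtype_coe.comp (AddCircle.measurableEquivIoc T a).measurable
  have hrπ : ∀ x ∈ Ioc a (a + T), r (π x) = x := fun x hx => by
    simp only [r, π]; rw [AddCircle.equivIoc_coe_eq hx]
  have hκr : κ.map r = ν := by
    rw [Measure.map_map hr hπ]
    conv_rhs => rw [← Measure.map_id (μ := ν)]
    exact Measure.map_congr (hmem.mono hrπ)
  have hgr : MemLp (g ∘ r) 2 κ := by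
    refine MemLp.comp_of_map ?_ hr.aemeasurable
    rwa [hκr]
  have hd : (Submodule.span ℂ (range fun n : ℤ => ContinuousMap.toLp (E := ℂ) 2 κ ℂ
      (fourier n))).topologicalClosure = ⊤ := by
    convert! (ContinuousMap.toLp_denseRange ℂ κ ℂ
      (p := 2) (by norm_num)).topologicalClosure_map_submodule span_fourier_closure_eq_top
    rw [Submodule.map_span, ← range_comp]
    rfl
  have hin : hgr.toLp ∈ (Submodule.span ℂ (range fun n : ℤ => ContinuousMap.toLp (E := ℂ) 2 κ ℂ
      (fourier n))).topologicalClosure := by rw [hd]; trivial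
  obtain ⟨y, hy, hlt⟩ := EMetric.mem_closure_iff.1 hin ε hε
  obtain ⟨c, rfl⟩ := Finsupp.mem_span_range_iff_exists_finsupp.1 hy
  refine ⟨c.support, c, ?_⟩
  rw [Lp.edist_def] at hlt
  have hQ : Continuous fun θ : AddCircle T => ∑ n ∈ c.support, c n * fourier n θ := by fun_prop
  have h1 : ⇑(hgr.toLp) - ⇑(c.sum fun n b => b • ContinuousMap.toLp (E := ℂ) 2 κ ℂ (fourier n))
      =ᵐ[κ] fun θ => (g ∘ r) θ - ∑ n ∈ c.support, c n * fourier n θ := by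
    have hL : ∀ n : ℤ, MemLp (fourier n : C(AddCircle T, ℂ)) 2 κ := fun n =>
      MemLp.of_bound (map_continuous _).aestronglyMeasurable 1
        (Eventually.of_forall fun x => (Circle.norm_coe _).le)
    filter_upwards [hgr.coeFn_toLp, MemLp.coeFn_finset_sum_smul_toLp hL c.support c] with θ h1 h2
    exact congrArg₂ (· - ·) h1 h2
  have h2 := eLpNorm_map_measure (p := 2) (hgr.1.sub hQ.aestronglyMeasurable) hπ.aemeasurable
  rw [eLpNorm_congr_ae h1] at hlt
  replace hlt := h2.symm.trans_lt hlt
  refine lt_of_le_of_lt (le_of_eq (eLpNorm_congr_ae ?_)) hlt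
  filter_upwards [hmem] with x hx
  have hx' := hrπ x hx
  simp only [π] at hx'
  simp only [Function.comp_apply, Pi.sub_apply, hx', trigPoly, π, fourier_coe_eq_osc]

end FourierSeries

/-! ### The optimum at a fixed frequency -/

section Pointwise

variable {ι : Type*} {p : ι → ℝ} {h e : ι → ℂ}

theorem summable_mul_norm (hp0 : ∀ k, 0 ≤ p k) (hp : Summable p)
    (hph : Summable fun k => p k * ‖h k‖ ^ 2) : Summable fun k => p k * ‖h k‖ := by
  refine Summable.of_nonneg_of_le (fun k => mul_nonneg (hp0 k) (norm_nonneg _)) (fun k => ?_)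
    (hp.add hph)
  nlinarith [hp0 k, sq_nonneg (‖h k‖ - 1), mul_nonneg (hp0 k) (sq_nonneg (‖h k‖ - 1)),
    mul_nonneg (hp0 k) (sq_nonneg ‖h k‖)]

theorem sq_mul_norm_sq_le (hp0 : ∀ k, 0 ≤ p k) (hp : Summable p) (k : ι) :
    p k ^ 2 * ‖h k‖ ^ 2 ≤ (∑' j, p j) * (p k * ‖h k‖ ^ 2) := by
  have : p k ≤ ∑' j, p j := hp.le_tsum k fun j _ => hp0 j
  have h2 := mul_le_mul_of_nonneg_right this (mul_nonneg (hp0 k) (sq_nonneg ‖h k‖))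
  nlinarith

theorem summable_sq_mul_norm_sq (hp0 : ∀ k, 0 ≤ p k) (hp : Summable p)
    (hph : Summable fun k => p k * ‖h k‖ ^ 2) : Summable fun k => p k ^ 2 * ‖h k‖ ^ 2 :=
  Summable.of_nonneg_of_le (fun k => by positivity) (sq_mul_norm_sq_le hp0 hp) (hph.mul_left _)

theorem summable_mul_conj_mul (hp0 : ∀ k, 0 ≤ p k) (hp : Summable p)
    (hph : Summable fun k => p k * ‖h k‖ ^ 2) (he : ∀ k, ‖e k‖ = 1) :
    Summable fun k => ‖(p k : ℂ) * (starRingEnd ℂ) (h k) * e k‖ := by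
  have : ∀ k, ‖(p k : ℂ) * (starRingEnd ℂ) (h k) * e k‖ = p k * ‖h k‖ := by
    intro k
    rw [norm_mul, norm_mul, he, mul_one, Complex.norm_real, RCLike.norm_conj,
      Real.norm_of_nonneg (hp0 k)]
  simpa only [this] using summable_mul_norm hp0 hp hph

/-- Completing the square in `z`, the value of the trigonometric polynomial at one frequency; `p`,
`h` and `e` are the values of `S`, `H` and `e_t` at its aliases. -/
theorem tsum_mul_norm_sub_sq_add (hp0 : ∀ k, 0 ≤ p k) (hp : Summable p)
    (hph : Summable fun k => p k * ‖h k‖ ^ 2) (he : ∀ k, ‖e k‖ = 1) {w : ℝ} (hw : 0 < w) (z : ℂ) :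
    (∑' k, p k * ‖e k - z * h k‖ ^ 2) + w * ‖z‖ ^ 2
      = (∑' k, p k) - ‖∑' k, (p k : ℂ) * (starRingEnd ℂ) (h k) * e k‖ ^ 2
            / ((∑' k, p k * ‖h k‖ ^ 2) + w)
        + ((∑' k, p k * ‖h k‖ ^ 2) + w) * ‖z - (∑' k, (p k : ℂ) * (starRingEnd ℂ) (h k) * e k)
            / (((∑' k, p k * ‖h k‖ ^ 2) + w : ℝ) : ℂ)‖ ^ 2 := by
  have hG := (summable_mul_conj_mul hp0 hp hph he).of_norm
  set G := ∑' k, (p k : ℂ) * (starRingEnd ℂ) (h k) * e k with hGdef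
  set A := ∑' k, p k * ‖h k‖ ^ 2 with hA
  have hA0 : 0 ≤ A := tsum_nonneg fun k => mul_nonneg (hp0 k) (sq_nonneg _)
  have hterm : ∀ k, p k * ‖e k - z * h k‖ ^ 2
      = p k - 2 * ((starRingEnd ℂ) z * ((p k : ℂ) * (starRingEnd ℂ) (h k) * e k)).re
        + ‖z‖ ^ 2 * (p k * ‖h k‖ ^ 2) := by
    intro k
    have h1 : ‖e k‖ ^ 2 = 1 := by rw [he]; norm_num
    rw [← Complex.normSq_eq_norm_sq] at h1 ⊢
    rw [← Complex.normSq_eq_norm_sq, ← Complex.normSq_eq_norm_sq, Complex.normSq_sub, h1]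
    rw [Complex.normSq_mul, map_mul]
    have : (starRingEnd ℂ) z * ((p k : ℂ) * (starRingEnd ℂ) (h k) * e k)
        = (p k : ℂ) * (e k * ((starRingEnd ℂ) z * (starRingEnd ℂ) (h k))) := by ring
    rw [this, Complex.re_ofReal_mul]
    ring
  have hre : HasSum (fun k => ((starRingEnd ℂ) z * ((p k : ℂ) * (starRingEnd ℂ) (h k) * e k)).re)
      ((starRingEnd ℂ) z * G).re :=
    Complex.hasSum_re (hG.hasSum.mul_left _)
  have hsum : ∑' k, p k * ‖e k - z * h k‖ ^ 2
      = (∑' k, p k) - 2 * ((starRingEnd ℂ) z * G).re + ‖z‖ ^ 2 * A := by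
    simp only [hterm]
    exact ((hp.hasSum.sub (hre.mul_left 2)).add (hph.hasSum.mul_left _)).tsum_eq
  rw [hsum]
  have hW : 0 < A + w := by positivity
  have h2 : ‖z - G / ((A + w : ℝ) : ℂ)‖ ^ 2
      = ‖z‖ ^ 2 + ‖G‖ ^ 2 / (A + w) ^ 2 - 2 * (((starRingEnd ℂ) z * G).re / (A + w)) := by
    rw [← Complex.normSq_eq_norm_sq, Complex.normSq_sub, Complex.normSq_eq_norm_sq,
      Complex.normSq_eq_norm_sq, norm_div, Complex.norm_real, Real.norm_of_nonneg hW.le, div_pow]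
    have : z * (starRingEnd ℂ) (G / ((A + w : ℝ) : ℂ))
        = (starRingEnd ℂ) ((starRingEnd ℂ) z * G) / ((A + w : ℝ) : ℂ) := by
      rw [map_div₀, map_mul, Complex.conj_conj, Complex.conj_ofReal, mul_div_assoc]
    rw [this, Complex.div_ofReal_re, Complex.conj_re]
  rw [h2]
  field_simp
  ring

/-- A Cauchy–Schwarz bound, read off from the completed square at its minimizer. -/
theorem norm_tsum_sq_div_le (hp0 : ∀ k, 0 ≤ p k) (hp : Summable p)
    (hph : Summable fun k => p k * ‖h k‖ ^ 2) (he : ∀ k, ‖e k‖ = 1) {w : ℝ} (hw : 0 < w) :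
    ‖∑' k, (p k : ℂ) * (starRingEnd ℂ) (h k) * e k‖ ^ 2 / ((∑' k, p k * ‖h k‖ ^ 2) + w)
      ≤ ∑' k, p k := by
  have := tsum_mul_norm_sub_sq_add hp0 hp hph he hw
    ((∑' k, (p k : ℂ) * (starRingEnd ℂ) (h k) * e k) / (((∑' k, p k * ‖h k‖ ^ 2) + w : ℝ) : ℂ))
  rw [sub_self, norm_zero] at this
  have h0 : 0 ≤ ∑' k, p k * ‖e k - ((∑' k, (p k : ℂ) * (starRingEnd ℂ) (h k) * e k) /
      (((∑' k, p k * ‖h k‖ ^ 2) + w : ℝ) : ℂ)) * h k‖ ^ 2 :=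
    tsum_nonneg fun k => mul_nonneg (hp0 k) (sq_nonneg _)
  nlinarith [mul_nonneg hw.le (sq_nonneg ‖(∑' k, (p k : ℂ) * (starRingEnd ℂ) (h k) * e k) /
    (((∑' k, p k * ‖h k‖ ^ 2) + w : ℝ) : ℂ)‖)]

theorem tsum_sq_mul_norm_sq_div_le (hp0 : ∀ k, 0 ≤ p k) (hp : Summable p)
    (hph : Summable fun k => p k * ‖h k‖ ^ 2) {w : ℝ} (hw : 0 < w) :
    (∑' k, p k ^ 2 * ‖h k‖ ^ 2) / ((∑' k, p k * ‖h k‖ ^ 2) + w) ≤ ∑' k, p k := by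
  have hA0 : 0 ≤ ∑' k, p k * ‖h k‖ ^ 2 := tsum_nonneg fun k => mul_nonneg (hp0 k) (sq_nonneg _)
  have hP0 : 0 ≤ ∑' k, p k := tsum_nonneg hp0
  have h1 := (summable_sq_mul_norm_sq hp0 hp hph).tsum_le_tsum (sq_mul_norm_sq_le hp0 hp)
    (hph.mul_left _)
  rw [tsum_mul_left] at h1
  rw [div_le_iff₀ (by positivity)]
  nlinarith

end Pointwise

/-! ### The optimum in the frequency domain -/

/-- The cross spectrum `∑_k S(f - f_s k) conj(H(f - f_s k)) e^{2πi(f - f_s k)t}` of `X(t)` and the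
samples, folded onto one period. -/
def foldedCross (fs : ℝ) (S : ℝ → ℝ) (H : ℝ → ℂ) (t f : ℝ) : ℂ :=
  ∑' k : ℤ, (S (f - fs * k) : ℂ) * (starRingEnd ℂ) (H (f - fs * k)) * osc t (f - fs * k)

/-- The power spectral density of the noisy samples, as a density in the frequency `f` over one
period: white noise of variance `v` spreads evenly over a period of length `f_s`. -/
def sampleSpectrum (fs v : ℝ) (S : ℝ → ℝ) (H : ℝ → ℂ) (f : ℝ) : ℝ :=
  aliasedSum fs (fun g => S g * ‖H g‖ ^ 2) f + v / fs

/-- The part `∫ |G_t|² / W` of the variance of `X(t)` that is explained by the noisy samples, where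
`G_t` is the folded cross spectrum and `W` the spectrum of the samples. The period is written as
`(a, a + f_s]` with `a = -f_s / 2`. -/
def explainedVariance (fs v : ℝ) (S : ℝ → ℝ) (H : ℝ → ℂ) (t : ℝ) : ℝ :=
  ∫ f in Set.Ioc (-fs / 2) (-fs / 2 + fs), ‖foldedCross fs S H t f‖ ^ 2 / sampleSpectrum fs v S H f

section FrequencyDomain

variable {fs v : ℝ} {S : ℝ → ℝ} {H : ℝ → ℂ}

theorem sampleSpectrum_pos (hfs : 0 < fs) (hv : 0 < v) (hS0 : ∀ f, 0 ≤ S f) (f : ℝ) :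
    0 < sampleSpectrum fs v S H f :=
  add_pos_of_nonneg_of_pos (tsum_nonneg fun _ => mul_nonneg (hS0 _) (sq_nonneg _)) (div_pos hv hfs)

theorem aestronglyMeasurable_translate {E : Type*} [TopologicalSpace E] {g : ℝ → E}
    (hg : AEStronglyMeasurable g volume) (a : ℝ) :
    AEStronglyMeasurable (fun f => g (f - a)) volume :=
  hg.comp_measurePreserving (measurePreserving_sub_right volume a)

theorem aestronglyMeasurable_aliasedSum (fs : ℝ) {g : ℝ → ℝ} (hg : AEStronglyMeasurable g volume) :
    AEStronglyMeasurable (aliasedSum fs g) volume :=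
  AEStronglyMeasurable.tsum fun k : ℤ => aestronglyMeasurable_translate hg (fs * k)

theorem aestronglyMeasurable_sampleSpectrum (fs v : ℝ) (hS : Integrable S)
    (hH : AEStronglyMeasurable H volume) :
    AEStronglyMeasurable (sampleSpectrum fs v S H) volume :=
  (aestronglyMeasurable_aliasedSum fs (hS.1.mul (hH.norm.pow 2))).add aestronglyMeasurable_const

theorem aestronglyMeasurable_foldedCross_uncurry (fs : ℝ) (hS : Integrable S)
    (hH : AEStronglyMeasurable H volume) (κ : Measure ℝ) [SFinite κ] :
    AEStronglyMeasurable (fun q : ℝ × ℝ => foldedCross fs S H q.1 q.2) (κ.prod volume) := by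
  refine AEStronglyMeasurable.tsum fun k : ℤ => ?_
  have h1 : AEStronglyMeasurable (fun f : ℝ => (S (f - fs * k) : ℂ) *
      (starRingEnd ℂ) (H (f - fs * k))) volume :=
    (Complex.continuous_ofReal.comp_aestronglyMeasurable
      (aestronglyMeasurable_translate hS.1 _)).mul
    (Complex.continuous_conj.comp_aestronglyMeasurable (aestronglyMeasurable_translate hH _))
  refine h1.comp_snd.mul (Continuous.aestronglyMeasurable ?_)
  exact continuous_osc_uncurry.comp (f := fun q : ℝ × ℝ => (q.1, q.2 - fs * k)) (by fun_prop)

theorem aestronglyMeasurable_foldedCross (fs t : ℝ) (hS : Integrable S)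
    (hH : AEStronglyMeasurable H volume) :
    AEStronglyMeasurable (foldedCross fs S H t) volume := by
  refine AEStronglyMeasurable.tsum fun k : ℤ => ?_
  refine ((Complex.continuous_ofReal.comp_aestronglyMeasurable
      (aestronglyMeasurable_translate hS.1 _)).mul
    (Complex.continuous_conj.comp_aestronglyMeasurable (aestronglyMeasurable_translate hH _))).mul
    (Continuous.aestronglyMeasurable ?_)
  exact (continuous_osc t).comp (by fun_prop : Continuous fun f : ℝ => f - fs * k)

theorem ae_summable_psd (hfs : 0 < fs) (hS : Integrable S)
    (hSH : Integrable fun f => S f * ‖H f‖ ^ 2) :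
    ∀ᵐ f : ℝ, Summable (fun k : ℤ => S (f - fs * k)) ∧
      Summable (fun k : ℤ => S (f - fs * k) * ‖H (f - fs * k)‖ ^ 2) := by
  filter_upwards [hS.ae_summable_translate hfs, hSH.ae_summable_translate hfs] with f h1 h2
  exact ⟨h1.of_norm, h2.of_norm⟩

theorem foldedCross_sq_div_le (hfs : 0 < fs) (hv : 0 < v) (hS : Integrable S) (hS0 : ∀ f, 0 ≤ S f)
    (hSH : Integrable fun f => S f * ‖H f‖ ^ 2) :
    ∀ᵐ f : ℝ, ∀ t, ‖foldedCross fs S H t f‖ ^ 2 / sampleSpectrum fs v S H f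
      ≤ ∑' k : ℤ, S (f - fs * k) := by
  filter_upwards [ae_summable_psd hfs hS hSH] with f hf t
  exact norm_tsum_sq_div_le (fun _ => hS0 _) hf.1 hf.2 (fun _ => norm_osc _ _) (div_pos hv hfs)

theorem integrableOn_foldedCross_sq_div (hfs : 0 < fs) (hv : 0 < v) (hS : Integrable S)
    (hS0 : ∀ f, 0 ≤ S f) (hH : AEStronglyMeasurable H volume)
    (hSH : Integrable fun f => S f * ‖H f‖ ^ 2) (t a : ℝ) :
    IntegrableOn (fun f => ‖foldedCross fs S H t f‖ ^ 2 / sampleSpectrum fs v S H f)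
      (Set.Ioc a (a + fs)) := by
  refine (hS.integrableOn_tsum_translate hfs a).mono'
    (((aestronglyMeasurable_foldedCross fs t hS hH).norm.pow 2).div₀
      (aestronglyMeasurable_sampleSpectrum fs v hS hH)).restrict ?_
  filter_upwards [ae_restrict_of_ae (foldedCross_sq_div_le hfs hv hS hS0 hSH)] with f hf
  rw [Real.norm_of_nonneg (div_nonneg (sq_nonneg _) (sampleSpectrum_pos hfs hv hS0 f).le)]
  exact hf t

theorem integrableOn_mmseIntegrand (hfs : 0 < fs) (hv : 0 < v) (hS : Integrable S)
    (hS0 : ∀ f, 0 ≤ S f) (hH : AEStronglyMeasurable H volume)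
    (hSH : Integrable fun f => S f * ‖H f‖ ^ 2) (a : ℝ) :
    IntegrableOn (mmseIntegrand fs v S H) (Set.Ioc a (a + fs)) := by
  refine (hS.integrableOn_tsum_translate hfs a).mono'
    ((aestronglyMeasurable_aliasedSum fs ((hS.1.pow 2).mul (hH.norm.pow 2))).div₀
      (aestronglyMeasurable_sampleSpectrum fs v hS hH)).restrict ?_
  filter_upwards [ae_restrict_of_ae (ae_summable_psd hfs hS hSH)] with f hf
  rw [Real.norm_of_nonneg]
  · exact tsum_sq_mul_norm_sq_div_le (fun _ => hS0 _) hf.1 hf.2 (div_pos hv hfs)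
  · exact div_nonneg (tsum_nonneg fun _ => by positivity) (sampleSpectrum_pos hfs hv hS0 f).le

/-- The frequency functions of the sampling times do not distinguish aliases. -/
theorem osc_int_mul (hfs : 0 < fs) (n k : ℤ) (f : ℝ) :
    osc (n / fs) (f - fs * k) = osc (n / fs) f := by
  have h1 : osc (n / fs) (f - fs * k)
      = Complex.exp (2 * Real.pi * Complex.I * f * ((n / fs : ℝ) : ℂ)
        + ((-(n * k) : ℤ) : ℂ) * (2 * Real.pi * Complex.I)) := by
    unfold osc
    congr 1
    have : (fs : ℂ) ≠ 0 := by exact_mod_cast hfs.ne'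
    push_cast
    field_simp
    ring
  rw [h1, Complex.exp_add, Complex.exp_int_mul_two_pi_mul_I, mul_one]
  rfl

theorem trigPoly_sub (hfs : 0 < fs) (s : Finset ℤ) (c : ℤ → ℂ) (f : ℝ) (k : ℤ) :
    trigPoly fs s c (f - fs * k) = trigPoly fs s c f := by
  simp only [trigPoly, osc_int_mul hfs]

theorem continuous_trigPoly (fs : ℝ) (s : Finset ℤ) (c : ℤ → ℂ) : Continuous (trigPoly fs s c) :=
  continuous_finsetSum _ fun _ _ => continuous_const.mul (continuous_osc _)

theorem norm_trigPoly_le (fs : ℝ) (s : Finset ℤ) (c : ℤ → ℂ) (f : ℝ) :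
    ‖trigPoly fs s c f‖ ≤ ∑ n ∈ s, ‖c n‖ :=
  norm_sum_le_of_le _ fun n _ => by rw [norm_mul, norm_osc, mul_one]

theorem setIntegral_norm_sq_trigPoly (hfs : 0 < fs) (a : ℝ) (s : Finset ℤ) (c : ℤ → ℂ) :
    ∫ f in Set.Ioc a (a + fs), ‖trigPoly fs s c f‖ ^ 2 = fs * ∑ n ∈ s, ‖c n‖ ^ 2 := by
  classical
  let d : ℤ → ℂ := fun n => if n ∈ s then c n else 0
  have hd : ∀ n ∉ s, d n = 0 := fun n hn => if_neg hn
  have hs : Summable fun n => ‖d n‖ :=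
    summable_of_ne_finset_zero (s := s) fun n hn => by rw [hd n hn, norm_zero]
  have h := setIntegral_norm_sq_tsum_osc hfs a hs
  have h1 : ∀ f, ∑' n : ℤ, d n * osc (n / fs) f = trigPoly fs s c f := by
    intro f
    rw [tsum_eq_sum (s := s) fun n hn => by rw [hd n hn, zero_mul]]
    exact Finset.sum_congr rfl fun n hn => by simp only [d, if_pos hn]
  have h2 : ∑' n, ‖d n‖ ^ 2 = ∑ n ∈ s, ‖c n‖ ^ 2 := by
    rw [tsum_eq_sum (s := s) fun n hn => by rw [hd n hn]; simp]
    exact Finset.sum_congr rfl fun n hn => by simp only [d, if_pos hn]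
  simpa only [h1, h2] using h

theorem integrable_cost (hS : Integrable S) (hS0 : ∀ f, 0 ≤ S f)
    (hH : AEStronglyMeasurable H volume)
    (hSH : Integrable fun f => S f * ‖H f‖ ^ 2) (fs t : ℝ) (s : Finset ℤ) (c : ℤ → ℂ) :
    Integrable fun f => S f * ‖osc t f - trigPoly fs s c f * H f‖ ^ 2 := by
  refine ((hS.const_mul 2).add (hSH.const_mul (2 * (∑ n ∈ s, ‖c n‖) ^ 2))).mono'
    (hS.1.mul ((((continuous_osc t).aestronglyMeasurable.sub
      ((continuous_trigPoly fs s c).aestronglyMeasurable.mul hH)).norm).pow 2))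
    (Eventually.of_forall fun f => ?_)
  rw [Real.norm_of_nonneg (mul_nonneg (hS0 f) (sq_nonneg _))]
  have h1 : ‖osc t f - trigPoly fs s c f * H f‖ ≤ 1 + (∑ n ∈ s, ‖c n‖) * ‖H f‖ := by
    refine (norm_sub_le _ _).trans ?_
    rw [norm_osc, norm_mul]
    have := mul_le_mul_of_nonneg_right (norm_trigPoly_le fs s c f) (norm_nonneg (H f))
    linarith
  have h2 : ‖osc t f - trigPoly fs s c f * H f‖ ^ 2
      ≤ 2 + 2 * ((∑ n ∈ s, ‖c n‖) * ‖H f‖) ^ 2 := by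
    have := pow_le_pow_left₀ (norm_nonneg _) h1 2
    nlinarith [sq_nonneg (1 - (∑ n ∈ s, ‖c n‖) * ‖H f‖)]
  calc S f * ‖osc t f - trigPoly fs s c f * H f‖ ^ 2
      ≤ S f * (2 + 2 * ((∑ n ∈ s, ‖c n‖) * ‖H f‖) ^ 2) := mul_le_mul_of_nonneg_left h2 (hS0 f)
    _ = _ := by simp only [Pi.add_apply]; ring

/-- The cost exceeds the residual variance by the squared weighted `L²` distance of the
trigonometric polynomial to the Wiener filter `foldedCross / sampleSpectrum`. -/
theorem spectralCost_eq (hfs : 0 < fs) (hv : 0 < v) (hS : Integrable S) (hS0 : ∀ f, 0 ≤ S f)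
    (hH : AEStronglyMeasurable H volume) (hSH : Integrable fun f => S f * ‖H f‖ ^ 2)
    (t : ℝ) (s : Finset ℤ) (c : ℤ → ℂ) :
    spectralCost S H fs v t s c = ((∫ f, S f) - explainedVariance fs v S H t)
      + ∫ f in Set.Ioc (-fs / 2) (-fs / 2 + fs), sampleSpectrum fs v S H f *
          ‖trigPoly fs s c f - foldedCross fs S H t f / (sampleSpectrum fs v S H f : ℂ)‖ ^ 2 := by
  set I := Set.Ioc (-fs / 2) (-fs / 2 + fs) with hI
  have hF := integrable_cost hS hS0 hH hSH fs t s c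
  have hpt : ∀ᵐ f ∂volume.restrict I,
      sampleSpectrum fs v S H f *
          ‖trigPoly fs s c f - foldedCross fs S H t f / (sampleSpectrum fs v S H f : ℂ)‖ ^ 2
      = (∑' k : ℤ, S (f - fs * k) * ‖osc t (f - fs * k)
            - trigPoly fs s c (f - fs * k) * H (f - fs * k)‖ ^ 2)
          + v / fs * ‖trigPoly fs s c f‖ ^ 2 - ∑' k : ℤ, S (f - fs * k)
          + ‖foldedCross fs S H t f‖ ^ 2 / sampleSpectrum fs v S H f := by
    filter_upwards [ae_restrict_of_ae (ae_summable_psd hfs hS hSH)] with f hf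
    have := tsum_mul_norm_sub_sq_add (fun k : ℤ => hS0 (f - fs * k)) hf.1 hf.2
      (fun k => norm_osc t (f - fs * k)) (div_pos hv hfs) (trigPoly fs s c f)
    simp only [trigPoly_sub hfs]
    rw [this]
    simp only [sampleSpectrum, aliasedSum, foldedCross]
    ring
  have hi1 := hF.integrableOn_tsum_translate hfs (-fs / 2)
  have hi2 : IntegrableOn (fun f => v / fs * ‖trigPoly fs s c f‖ ^ 2) I :=
    (Continuous.integrableOn_Ioc (by have := continuous_trigPoly fs s c; fun_prop))
  have hi3 := hS.integrableOn_tsum_translate hfs (-fs / 2)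
  have hi4 := integrableOn_foldedCross_sq_div hfs hv hS hS0 hH hSH t (-fs / 2)
  have hsplit : ∀ {g₁ g₂ g₃ g₄ : ℝ → ℝ}, IntegrableOn g₁ I → IntegrableOn g₂ I →
      IntegrableOn g₃ I → IntegrableOn g₄ I → ∫ f in I, (g₁ f + g₂ f - g₃ f + g₄ f)
        = (∫ f in I, g₁ f) + (∫ f in I, g₂ f) - (∫ f in I, g₃ f) + ∫ f in I, g₄ f := by
    intro g₁ g₂ g₃ g₄ h₁ h₂ h₃ h₄
    have e₁ := integral_add h₁ h₂
    have e₂ := integral_sub (h₁.add h₂) h₃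
    have e₃ := integral_add ((h₁.add h₂).sub h₃) h₄
    simp only [Pi.add_apply, Pi.sub_apply] at e₁ e₂ e₃
    rw [e₃, e₂, e₁]
  rw [integral_congr_ae hpt, hsplit hi1 hi2 hi3 hi4,
    hF.setIntegral_tsum_translate hfs, hS.setIntegral_tsum_translate hfs,
    integral_const_mul, setIntegral_norm_sq_trigPoly hfs, spectralCost, explainedVariance,
    ← mul_assoc, div_mul_cancel₀ v hfs.ne']
  ring

end FrequencyDomain

/-! ### The infimum over the coefficients -/

section Infimum

variable {fs v : ℝ} {S : ℝ → ℝ} {H : ℝ → ℂ}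

theorem residual_le_spectralCost (hfs : 0 < fs) (hv : 0 < v) (hS : Integrable S)
    (hS0 : ∀ f, 0 ≤ S f)
    (hH : AEStronglyMeasurable H volume) (hSH : Integrable fun f => S f * ‖H f‖ ^ 2)
    (t : ℝ) (s : Finset ℤ) (c : ℤ → ℂ) :
    (∫ f, S f) - explainedVariance fs v S H t ≤ spectralCost S H fs v t s c := by
  rw [spectralCost_eq hfs hv hS hS0 hH hSH]
  exact le_add_of_nonneg_right (integral_nonneg fun f =>
    mul_nonneg (sampleSpectrum_pos hfs hv hS0 f).le (sq_nonneg _))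

/-- The residual variance is approached, by approximating the Wiener filter in `L²(W df)` by
trigonometric polynomials. -/
theorem exists_spectralCost_lt (hfs : 0 < fs) (hv : 0 < v) (hS : Integrable S)
    (hS0 : ∀ f, 0 ≤ S f)
    (hH : AEStronglyMeasurable H volume) (hSH : Integrable fun f => S f * ‖H f‖ ^ 2)
    (t : ℝ) {ε : ℝ} (hε : 0 < ε) :
    ∃ (s : Finset ℤ) (c : ℤ → ℂ),
      spectralCost S H fs v t s c < (∫ f, S f) - explainedVariance fs v S H t + ε := by
  set I := Set.Ioc (-fs / 2) (-fs / 2 + fs) with hI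
  have hIm : MeasurableSet I := measurableSet_Ioc
  set W := sampleSpectrum fs v S H with hW
  have hWpos : ∀ f, 0 < W f := sampleSpectrum_pos hfs hv hS0
  have hWint : IntegrableOn W I :=
    (hSH.integrableOn_tsum_translate hfs (-fs / 2)).add (integrableOn_const (by simp))
  -- the weighted space `L²(W df)` on one period, with the weight extended by zero
  have hwi : Integrable (I.indicator W) := (integrable_indicator_iff hIm).2 hWint
  have hw0 : ∀ f, 0 ≤ I.indicator W f := Set.indicator_nonneg fun f _ => (hWpos f).le
  have := isFiniteMeasure_psdMeasure hwi
  set ν := psdMeasure (I.indicator W) with hν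
  have hνI : ν Iᶜ = 0 := by
    rw [hν, psdMeasure, withDensity_apply _ hIm.compl]
    refine setLIntegral_eq_zero hIm.compl fun f hf => ?_
    simp [Set.indicator_of_notMem (show f ∉ I from hf)]
  have hint : ∀ g : ℝ → ℝ, ∫ f, g f ∂ν = ∫ f in I, W f * g f := by
    intro g
    rw [integral_psdMeasure hwi hw0, ← integral_indicator hIm]
    refine integral_congr_ae (Eventually.of_forall fun f => ?_)
    by_cases hf : f ∈ I <;> simp [hf]
  have hGm : AEStronglyMeasurable (fun f => foldedCross fs S H t f / (W f : ℂ)) volume :=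
    (aestronglyMeasurable_foldedCross fs t hS hH).div₀
      (Complex.continuous_ofReal.comp_aestronglyMeasurable
        (aestronglyMeasurable_sampleSpectrum fs v hS hH))
  have hg : MemLp (fun f => foldedCross fs S H t f / (W f : ℂ)) 2 ν := by
    rw [memLp_two_iff_integrable_sq_norm (hGm.mono_ac (psdMeasure_absolutelyContinuous _)),
      integrable_psdMeasure_iff hwi hw0]
    refine ((integrable_indicator_iff hIm).2
      (integrableOn_foldedCross_sq_div hfs hv hS hS0 hH hSH t (-fs / 2))).congr
      (Eventually.of_forall fun f => ?_)
    by_cases hf : f ∈ I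
    · have h0 := (hWpos f).ne'
      simp only [Set.indicator_of_mem hf, smul_eq_mul, norm_div,
        Complex.norm_real, Real.norm_of_nonneg (hWpos f).le]
      rw [div_pow, ← hW]
      field_simp
    · simp [hf]
  obtain ⟨s, c, hlt⟩ := exists_trigPoly_eLpNorm_sub_lt hfs (-fs / 2) ν hνI hg
    (ε := ENNReal.ofReal (Real.sqrt ε)) (by simpa using hε)
  refine ⟨s, c, ?_⟩
  rw [spectralCost_eq hfs hv hS hS0 hH hSH, add_lt_add_iff_left]
  have hd : MemLp (fun f => foldedCross fs S H t f / (W f : ℂ) - trigPoly fs s c f) 2 ν :=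
    ⟨hg.1.sub (continuous_trigPoly fs s c).aestronglyMeasurable, hlt.trans ENNReal.ofReal_lt_top⟩
  have h1 := norm_toLp_two_sq hd.coeFn_toLp
  rw [hint] at h1
  have h2 : ‖hd.toLp‖ < Real.sqrt ε := by
    rw [Lp.norm_toLp]
    exact (ENNReal.lt_ofReal_iff_toReal_lt hlt.ne_top).1 hlt
  have h3 : ‖hd.toLp‖ ^ 2 < ε := by
    have := pow_lt_pow_left₀ h2 (norm_nonneg _) two_ne_zero
    rwa [Real.sq_sqrt hε.le] at this
  rw [h1] at h3
  simpa only [norm_sub_rev] using h3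

end Infimum

/-! ### Averaging over time -/

section Average

variable {fs v : ℝ} {S : ℝ → ℝ} {H : ℝ → ℂ}

/-- Up to a phase, the folded cross spectrum at a fixed frequency is a Fourier series in `t` of
period `1 / f_s`. -/
theorem norm_foldedCross_eq (t f : ℝ) :
    ‖foldedCross fs S H t f‖ = ‖∑' n : ℤ, (S (f + fs * n) : ℂ) *
      (starRingEnd ℂ) (H (f + fs * n)) * osc (n / (1 / fs)) t‖ := by
  have h1 : foldedCross fs S H t f = osc t f * ∑' n : ℤ, (S (f + fs * n) : ℂ) *
      (starRingEnd ℂ) (H (f + fs * n)) * osc (n / (1 / fs)) t := by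
    rw [foldedCross, ← (Equiv.neg ℤ).tsum_eq, ← tsum_mul_left]
    refine tsum_congr fun n => ?_
    have h2 : f - fs * (((Equiv.neg ℤ) n : ℤ) : ℝ) = f + fs * n := by simp
    have h3 : osc t (f + fs * n) = osc t f * osc (n / (1 / fs)) t := by
      unfold osc
      rw [← Complex.exp_add]
      congr 1
      push_cast
      field_simp
    rw [h2, h3]
    ring
  rw [h1, norm_mul, norm_osc, one_mul]

theorem explainedVariance_periodic (hfs : 0 < fs) :
    Function.Periodic (explainedVariance fs v S H) (1 / fs) := by
  intro t
  unfold explainedVariance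
  refine integral_congr_ae (Eventually.of_forall fun f => ?_)
  have h : ∀ n : ℤ, osc (n / (1 / fs)) (t + 1 / fs) = osc (n / (1 / fs)) t := by
    intro n
    have := osc_int_mul (one_div_pos.2 hfs) n (-1) t
    simpa using this
  simp only [norm_foldedCross_eq, h]

theorem setIntegral_norm_sq_foldedCross (hfs : 0 < fs) (hS0 : ∀ f, 0 ≤ S f) {f : ℝ}
    (h1 : Summable fun k : ℤ => S (f - fs * k))
    (h2 : Summable fun k : ℤ => S (f - fs * k) * ‖H (f - fs * k)‖ ^ 2) :
    ∫ t in Set.Ioc 0 (0 + 1 / fs), ‖foldedCross fs S H t f‖ ^ 2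
      = 1 / fs * aliasedSum fs (fun g => S g ^ 2 * ‖H g‖ ^ 2) f := by
  have hs : Summable fun n : ℤ => ‖(S (f + fs * n) : ℂ) * (starRingEnd ℂ) (H (f + fs * n))‖ := by
    have := (Equiv.neg ℤ).summable_iff.2
      (summable_mul_conj_mul (e := fun _ => 1) (fun k : ℤ => hS0 (f - fs * k)) h1 h2 (by simp))
    refine this.congr fun n => ?_
    simp
  simp only [norm_foldedCross_eq]
  rw [setIntegral_norm_sq_tsum_osc (one_div_pos.2 hfs) 0 hs, aliasedSum,
    ← (Equiv.neg ℤ).tsum_eq (fun k : ℤ => S (f - fs * k) ^ 2 * ‖H (f - fs * k)‖ ^ 2)]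
  congr 1
  refine tsum_congr fun n => ?_
  rw [norm_mul, RCLike.norm_conj, Complex.norm_real, Real.norm_of_nonneg (hS0 _), mul_pow]
  simp

/-- By Fubini and Parseval's identity in `t`, the mean of the explained variance over a period of
length `1 / f_s` is the integral of `mmseIntegrand`. -/
theorem integral_explainedVariance (hfs : 0 < fs) (hv : 0 < v) (hS : Integrable S)
    (hS0 : ∀ f, 0 ≤ S f)
    (hH : AEStronglyMeasurable H volume) (hSH : Integrable fun f => S f * ‖H f‖ ^ 2) :
    ∫ t in (0 : ℝ)..1 / fs, explainedVariance fs v S H t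
      = 1 / fs * ∫ f in (-fs / 2)..(fs / 2), mmseIntegrand fs v S H f := by
  have hI : Set.Ioc (-fs / 2) (-fs / 2 + fs) = Set.Ioc (-fs / 2) (fs / 2) := by
    congr 1; ring
  rw [intervalIntegral.integral_of_le (by positivity),
    intervalIntegral.integral_of_le (by linarith), ← hI]
  unfold explainedVariance
  rw [integral_integral_swap]
  · rw [← integral_const_mul]
    refine integral_congr_ae ?_
    filter_upwards [ae_restrict_of_ae (ae_summable_psd hfs hS hSH)] with f hf
    rw [integral_div]
    have := setIntegral_norm_sq_foldedCross hfs hS0 hf.1 hf.2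
    rw [zero_add] at this
    rw [this, mmseIntegrand, sampleSpectrum, mul_div_assoc]
  · have hfin : IsFiniteMeasure (volume.restrict (Set.Ioc (0 : ℝ) (1 / fs))) :=
      ⟨by simp⟩
    have hb := Integrable.comp_snd (hS.integrableOn_tsum_translate hfs (-fs / 2))
      (volume.restrict (Set.Ioc (0 : ℝ) (1 / fs)))
    refine hb.mono' ?_ ?_
    · have hac : (volume.restrict (Set.Ioc (0 : ℝ) (1 / fs))).prod
          (volume.restrict (Set.Ioc (-fs / 2) (-fs / 2 + fs)))
          ≪ (volume.restrict (Set.Ioc (0 : ℝ) (1 / fs))).prod volume :=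
        Measure.AbsolutelyContinuous.prod Measure.AbsolutelyContinuous.rfl
          Measure.restrict_le_self.absolutelyContinuous
      exact (((aestronglyMeasurable_foldedCross_uncurry fs hS hH _).norm.pow 2).div₀
        (aestronglyMeasurable_sampleSpectrum fs v hS hH).comp_snd).mono_ac hac
    · have := Measure.quasiMeasurePreserving_snd
        (μ := volume.restrict (Set.Ioc (0 : ℝ) (1 / fs)))
        (ν := volume.restrict (Set.Ioc (-fs / 2) (-fs / 2 + fs)))
      filter_upwards [this.ae (ae_restrict_of_ae (foldedCross_sq_div_le hfs hv hS hS0 hSH))]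
        with q hq
      rw [Function.uncurry, Real.norm_of_nonneg
        (div_nonneg (sq_nonneg _) (sampleSpectrum_pos hfs hv hS0 _).le)]
      exact hq _

/-- The time averages of a continuous periodic function tend to its mean over a period. -/
theorem Function.Periodic.tendsto_average {g : ℝ → ℝ} {T₀ : ℝ} (hg : Function.Periodic g T₀)
    (hT : 0 < T₀) (hc : Continuous g) :
    Tendsto (fun T : ℝ => 1 / (2 * T) * ∫ t in (-T)..T, g t) atTop
      (𝓝 (1 / T₀ * ∫ t in (0 : ℝ)..T₀, g t)) := by
  set m := 1 / T₀ * ∫ t in (0 : ℝ)..T₀, g t with hm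
  -- the primitive of the centred function is continuous and periodic, hence bounded
  let F : ℝ → ℝ := fun x => ∫ t in (0 : ℝ)..x, (g t - m)
  have hii : ∀ a b, IntervalIntegrable (fun t => g t - m) volume a b := fun a b =>
    (hc.sub continuous_const).intervalIntegrable a b
  have hper : Function.Periodic (fun t => g t - m) T₀ := fun t => by simp only [hg t]
  have h0 : ∫ t in (0 : ℝ)..T₀, (g t - m) = 0 := by
    rw [intervalIntegral.integral_sub (hc.intervalIntegrable _ _) (by simp), hm]
    simp only [intervalIntegral.integral_const, smul_eq_mul]
    field_simp
    ring
  have hFper : Function.Periodic F T₀ := by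
    intro x
    change ∫ t in (0 : ℝ)..(x + T₀), (g t - m) = ∫ t in (0 : ℝ)..x, (g t - m)
    rw [← intervalIntegral.integral_add_adjacent_intervals (hii 0 x) (hii x (x + T₀)),
      hper.intervalIntegral_add_eq x 0, zero_add, h0, add_zero]
  have hFc : Continuous F := intervalIntegral.continuous_primitive hii 0
  obtain ⟨B, hB⟩ := hFper.isBounded_of_continuous hT.ne' hFc |>.exists_norm_le
  have hB' : ∀ x, |F x| ≤ B := fun x => hB _ ⟨x, rfl⟩
  have heq : ∀ᶠ T : ℝ in atTop, 1 / (2 * T) * (F T - F (-T)) + m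
      = 1 / (2 * T) * ∫ t in (-T)..T, g t := by
    filter_upwards [eventually_gt_atTop 0] with T hTpos
    have h1 : F T - F (-T) = ∫ t in (-T)..T, (g t - m) :=
      intervalIntegral.integral_interval_sub_left (hii _ _) (hii _ _)
    rw [h1, intervalIntegral.integral_sub (hc.intervalIntegrable _ _) (by simp)]
    simp only [intervalIntegral.integral_const, smul_eq_mul]
    field_simp
    ring
  refine Tendsto.congr' heq ?_
  have hz : Tendsto (fun T : ℝ => 1 / (2 * T) * (F T - F (-T))) atTop (𝓝 0) := by
    refine Tendsto.zero_mul_isBoundedUnder_le ?_ ?_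
    · exact (tendsto_const_nhds.div_atTop (tendsto_id.const_mul_atTop two_pos))
    · refine isBoundedUnder_of ⟨B + B, fun T => ?_⟩
      exact (norm_sub_le _ _).trans (add_le_add (hB' _) (hB' _))
  simpa using hz.add_const m

end Average

/-! ### The distance to the span of the samples -/

section Samples

variable {Ω : Type*} [MeasurableSpace Ω] {P : Measure Ω}
  {X Z : ℝ → Ω → ℝ} {η : ℤ → Ω → ℝ} {S : ℝ → ℝ} {H : ℝ → ℂ} {fs v : ℝ}

theorem IsFilterOutput.integrable_psd_mul (hX : IsStationaryWithPSD P X S)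
    (hH : AEStronglyMeasurable H volume) (hZ : IsFilterOutput P X S H Z) :
    Integrable fun f => S f * ‖H f‖ ^ 2 := by
  have h := hZ.memLp_freq hX hH 0
  rw [memLp_two_iff_integrable_sq_norm h.1,
    integrable_psdMeasure_iff hX.psd_integrable hX.psd_nonneg] at h
  simpa using h

/-- The noisy sample `Ŷ[n]` as a vector of `L²(P)`. -/
def sampleVec (hZ : IsFilterOutput P X S H Z) (hη : IsWhiteNoise P X η v) (fs : ℝ) (n : ℤ) :
    Lp ℝ 2 P :=
  (memLp_quantizedSamples hZ hη fs n).toLp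

/-- The subspace of `L²(P)` spanned by the noisy samples. -/
def sampleSpan (hZ : IsFilterOutput P X S H Z) (hη : IsWhiteNoise P X η v) (fs : ℝ) :
    Submodule ℝ (Lp ℝ 2 P) :=
  Submodule.span ℝ (Set.range (sampleVec hZ hη fs))

theorem sum_mem_sampleSpan (hZ : IsFilterOutput P X S H Z) (hη : IsWhiteNoise P X η v) (fs : ℝ)
    (s : Finset ℤ) (c : ℤ → ℝ) : ∑ n ∈ s, c n • sampleVec hZ hη fs n ∈ sampleSpan hZ hη fs :=
  Submodule.sum_mem _ fun n _ => Submodule.smul_mem _ _ (Submodule.subset_span ⟨n, rfl⟩)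

theorem residual_le_norm_sub_sq [IsProbabilityMeasure P] (hfs : 0 < fs)
    (hv : 0 < v) (hX : IsStationaryWithPSD P X S)
    (hH : AEStronglyMeasurable H volume) (hZ : IsFilterOutput P X S H Z)
    (hη : IsWhiteNoise P X η v) (t : ℝ) {u : Lp ℝ 2 P}
    (hu : u ∈ (sampleSpan hZ hη fs).topologicalClosure) :
    (∫ f, S f) - explainedVariance fs v S H t ≤ ‖hX.vec t - u‖ ^ 2 := by
  have hcl : IsClosed {u : Lp ℝ 2 P |
      (∫ f, S f) - explainedVariance fs v S H t ≤ ‖hX.vec t - u‖ ^ 2} :=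
    isClosed_le continuous_const (by fun_prop)
  refine hcl.closure_subset_iff.2 ?_ hu
  intro u hu
  obtain ⟨c, rfl⟩ := Finsupp.mem_span_range_iff_exists_finsupp.1 hu
  have := norm_vec_sub_sum_sq hX hH hZ hη fs t c.support c
  refine (residual_le_spectralCost hfs hv hX.psd_integrable hX.psd_nonneg hH
    (hZ.integrable_psd_mul hX hH) t c.support fun n => (c n : ℂ)).trans this.ge

theorem exists_norm_sub_sq_lt [IsProbabilityMeasure P] (hfs : 0 < fs)
    (hv : 0 < v) (hX : IsStationaryWithPSD P X S)
    (hH : AEStronglyMeasurable H volume) (hZ : IsFilterOutput P X S H Z)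
    (hη : IsWhiteNoise P X η v) (t : ℝ) {ε : ℝ} (hε : 0 < ε) :
    ∃ u ∈ sampleSpan hZ hη fs,
      ‖hX.vec t - u‖ ^ 2 < (∫ f, S f) - explainedVariance fs v S H t + ε := by
  obtain ⟨s, c, h⟩ := exists_spectralCost_lt hfs hv hX.psd_integrable hX.psd_nonneg hH
    (hZ.integrable_psd_mul hX hH) t hε
  refine ⟨_, sum_mem_sampleSpan hZ hη fs s fun n => (c n).re, ?_⟩
  have h1 := norm_vec_sub_sum_sq hX hH hZ hη fs t s fun n => (c n).re
  exact h1.trans_lt ((spectralCost_re_le hX hH hZ hv.le fs t s c).trans_lt h)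

theorem IsStationaryWithPSD.continuous_vec (hX : IsStationaryWithPSD P X S) :
    Continuous hX.vec := by
  rw [continuous_iff_continuousAt]
  intro t₀
  have hsq : ∀ t, ‖hX.vec t - hX.vec t₀‖ ^ 2 = ∫ f, S f * ‖osc t f - osc t₀ f‖ ^ 2 := by
    intro t
    have hmem := Submodule.sub_mem _ (hX.vec_mem t) (hX.vec_mem t₀)
    have h1 := norm_eq_of_inner_eq (hX.inner_eq_of_mem hmem hmem)
    rw [Prod.fst_sub, Prod.snd_sub] at h1
    rw [h1, norm_toLp_two_sq (f := fun f => osc t f - osc t₀ f),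
      integral_psdMeasure hX.psd_integrable hX.psd_nonneg]
    · rfl
    · filter_upwards [Lp.coeFn_sub (hX.freq t) (hX.freq t₀),
        (memLp_osc hX.psd_integrable t).coeFn_toLp,
        (memLp_osc hX.psd_integrable t₀).coeFn_toLp] with f h1 h2 h3
      rw [h1, Pi.sub_apply, IsStationaryWithPSD.freq, IsStationaryWithPSD.freq, h2, h3]
  have hcont : Continuous fun t => ∫ f, S f * ‖osc t f - osc t₀ f‖ ^ 2 := by
    refine continuous_of_dominated (bound := fun f => S f * 4) (fun t => ?_) (fun t => ?_)
      (hX.psd_integrable.mul_const 4) ?_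
    · exact hX.psd_integrable.1.mul
        (((continuous_osc t).sub (continuous_osc t₀)).norm.pow 2).aestronglyMeasurable
    · refine Eventually.of_forall fun f => ?_
      rw [Real.norm_of_nonneg (mul_nonneg (hX.psd_nonneg f) (sq_nonneg _))]
      refine mul_le_mul_of_nonneg_left ?_ (hX.psd_nonneg f)
      have h2 : ‖osc t f - osc t₀ f‖ ≤ 2 := by
        refine (norm_sub_le _ _).trans ?_
        rw [norm_osc, norm_osc]; norm_num
      nlinarith [norm_nonneg (osc t f - osc t₀ f)]
    · refine Eventually.of_forall fun f => ?_
      have : Continuous fun t => osc t f :=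
        continuous_osc_uncurry.comp (f := fun t : ℝ => (t, f)) (by fun_prop)
      fun_prop
  have h0 : Tendsto (fun t => ‖hX.vec t - hX.vec t₀‖ ^ 2) (𝓝 t₀) (𝓝 0) := by
    simp only [hsq]
    have := hcont.tendsto t₀
    simpa using this
  rw [ContinuousAt, tendsto_iff_norm_sub_tendsto_zero]
  have := h0.sqrt
  simpa [Real.sqrt_sq (norm_nonneg _)] using this

/-- The residual variance is the squared distance from `X(t)` to the span of the samples. -/
theorem infDist_vec_sq [IsProbabilityMeasure P] (hfs : 0 < fs)
    (hv : 0 < v) (hX : IsStationaryWithPSD P X S)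
    (hH : AEStronglyMeasurable H volume) (hZ : IsFilterOutput P X S H Z)
    (hη : IsWhiteNoise P X η v) (t : ℝ) :
    Metric.infDist (hX.vec t) (sampleSpan hZ hη fs) ^ 2
      = (∫ f, S f) - explainedVariance fs v S H t := by
  refine le_antisymm (le_of_forall_pos_lt_add fun ε hε => ?_) ?_
  · obtain ⟨u, hu, hlt⟩ := exists_norm_sub_sq_lt hfs hv hX hH hZ hη t hε
    refine lt_of_le_of_lt (pow_le_pow_left₀ Metric.infDist_nonneg ?_ 2) hlt
    rw [← dist_eq_norm]
    exact Metric.infDist_le_dist_of_mem hu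
  · rw [← Real.sqrt_le_left Metric.infDist_nonneg]
    refine (Metric.le_infDist ⟨0, Submodule.zero_mem _⟩).2 fun u hu => ?_
    rw [dist_eq_norm]
    exact Real.sqrt_le_left (norm_nonneg _) |>.2
      (residual_le_norm_sub_sq hfs hv hX hH hZ hη t (Submodule.le_topologicalClosure _ hu))

theorem continuous_explainedVariance [IsProbabilityMeasure P] (hfs : 0 < fs)
    (hv : 0 < v) (hX : IsStationaryWithPSD P X S)
    (hH : AEStronglyMeasurable H volume) (hZ : IsFilterOutput P X S H Z)
    (hη : IsWhiteNoise P X η v) : Continuous (explainedVariance fs v S H) := by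
  have h : explainedVariance fs v S H = fun t =>
      (∫ f, S f) - Metric.infDist (hX.vec t) (sampleSpan hZ hη fs) ^ 2 := by
    ext t
    rw [infDist_vec_sq hfs hv hX hH hZ hη]
    ring
  rw [h]
  have := (Metric.continuous_infDist_pt (sampleSpan hZ hη fs : Set (Lp ℝ 2 P))).comp
    hX.continuous_vec
  exact continuous_const.sub (this.pow 2)

theorem tendsto_average_residual [IsProbabilityMeasure P] (hfs : 0 < fs)
    (hv : 0 < v) (hX : IsStationaryWithPSD P X S)
    (hH : AEStronglyMeasurable H volume) (hZ : IsFilterOutput P X S H Z)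
    (hη : IsWhiteNoise P X η v) :
    Tendsto (fun T : ℝ => 1 / (2 * T) *
        ∫ t in (-T)..T, ((∫ f, S f) - explainedVariance fs v S H t)) atTop
      (𝓝 ((∫ f, S f) - ∫ f in (-fs / 2)..(fs / 2), mmseIntegrand fs v S H f)) := by
  have hc := continuous_explainedVariance hfs hv hX hH hZ hη
  have hT : 0 < 1 / fs := one_div_pos.2 hfs
  have hper : Function.Periodic (fun t => (∫ f, S f) - explainedVariance fs v S H t) (1 / fs) :=
    fun t => by simp only [explainedVariance_periodic hfs t]
  have h := hper.tendsto_average hT (continuous_const.sub hc)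
  rw [intervalIntegral.integral_sub (by simp) (hc.intervalIntegrable _ _),
    integral_explainedVariance hfs hv hX.psd_integrable hX.psd_nonneg hH
      (hZ.integrable_psd_mul hX hH), intervalIntegral.integral_const] at h
  convert h using 2
  simp only [sub_zero, smul_eq_mul]
  field_simp

theorem meanSquaredError_eq_norm_sq (hX : IsStationaryWithPSD P X S) {Xhat : ℝ → Ω → ℝ} (t : ℝ)
    {u : Lp ℝ 2 P} (h : u =ᵐ[P] Xhat t) : meanSquaredError P X Xhat t = ‖hX.vec t - u‖ ^ 2 := by
  rw [norm_toLp_two_sq (f := fun ω => X t ω - Xhat t ω), meanSquaredError]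
  · simp only [Real.norm_eq_abs, sq_abs]
  · filter_upwards [Lp.coeFn_sub (hX.vec t) u, (hX.memLp t).coeFn_toLp, h] with ω h1 h2 h3
    rw [h1, Pi.sub_apply, IsStationaryWithPSD.vec, h2, h3]

/-! ### The lower bound -/

/-- The lower bound holds for every notion of infinite sum whose values lie in the closed span of
the samples. -/
theorem residual_le_of_mem_linearMSEs [IsProbabilityMeasure P] (hfs : 0 < fs)
    (hv : 0 < v) (hX : IsStationaryWithPSD P X S)
    (hH : AEStronglyMeasurable H volume) (hZ : IsFilterOutput P X S H Z)
    (hη : IsWhiteNoise P X η v) {IsSum : (ℤ → ℝ) → (Ω → ℝ) → Prop}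
    (hIs : ∀ w V, IsSum w V → ∃ u ∈ (sampleSpan hZ hη fs).topologicalClosure, u =ᵐ[P] V)
    {D : ℝ} (hD : D ∈ linearMSEs P X IsSum) :
    (∫ f, S f) - ∫ f in (-fs / 2)..(fs / 2), mmseIntegrand fs v S H f ≤ D := by
  obtain ⟨w, Xhat, hw, hint, hlim⟩ := hD
  have hc := continuous_explainedVariance hfs hv hX hH hZ hη
  refine le_of_tendsto_of_tendsto (tendsto_average_residual hfs hv hX hH hZ hη) hlim ?_
  filter_upwards [eventually_gt_atTop 0] with T hT
  refine mul_le_mul_of_nonneg_left ?_ (by positivity)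
  refine intervalIntegral.integral_mono_on (by linarith)
    ((continuous_const.sub hc).intervalIntegrable _ _) (hint T) fun t _ => ?_
  obtain ⟨u, hu, huV⟩ := hIs _ _ (hw t)
  rw [meanSquaredError_eq_norm_sq hX t huV]
  exact residual_le_norm_sub_sq hfs hv hX hH hZ hη t hu

/-- A mean-square limit of finite linear combinations of the samples lies in their closed span. -/
theorem exists_mem_closure_of_tendsto (hZ : IsFilterOutput P X S H Z) (hη : IsWhiteNoise P X η v)
    {V : Ω → ℝ} (hV : MemLp V 2 P) (s : ℕ → Finset ℤ) (c : ℕ → ℤ → ℝ)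
    (h : Tendsto (fun k => eLpNorm (fun ω => V ω - ∑ n ∈ s k, c k n * quantizedSamples fs Z η n ω)
      2 P) atTop (𝓝 0)) :
    ∃ u ∈ (sampleSpan hZ hη fs).topologicalClosure, u =ᵐ[P] V := by
  refine ⟨hV.toLp, ?_, hV.coeFn_toLp⟩
  refine mem_closure_of_tendsto (b := atTop)
    (f := fun k => ∑ n ∈ s k, c k n • sampleVec hZ hη fs n) ?_
    (Eventually.of_forall fun k => sum_mem_sampleSpan hZ hη fs (s k) (c k))
  rw [tendsto_iff_edist_tendsto_0]
  refine h.congr fun k => ?_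
  rw [edist_comm, Lp.edist_def]
  refine eLpNorm_congr_ae ?_
  filter_upwards [hV.coeFn_toLp, MemLp.coeFn_finset_sum_smul_toLp
    (memLp_quantizedSamples hZ hη fs) (s k) (c k)] with ω h1 h2
  exact (congrArg₂ (· - ·) h1 h2).symm

/-! ### The optimal reconstruction -/

/-- The noise alone contributes `v ∑ c n ^ 2` to the variance of `∑ c n Ŷ[n]`. -/
theorem mul_sum_sq_le_norm_sq [IsProbabilityMeasure P] (hX : IsStationaryWithPSD P X S)
    (hH : AEStronglyMeasurable H volume) (hZ : IsFilterOutput P X S H Z)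
    (hη : IsWhiteNoise P X η v) (s : Finset ℤ) (c : ℤ → ℝ) :
    v * ∑ n ∈ s, c n ^ 2 ≤ ‖∑ n ∈ s, c n • sampleVec hZ hη fs n‖ ^ 2 := by
  have hmem := Submodule.neg_mem _
    (hZ.sum_mem_spectralPairs hX hH (fun n : ℤ => n / fs) s c)
  have h := hη.norm_sub_sum_sq hX hmem s c
  have hy : ∀ n, sampleVec hZ hη fs n = (hZ.memLp (n / fs)).toLp + (hη.memLp n).toLp :=
    fun n => MemLp.toLp_add _ _
  simp only [hy, smul_add, Finset.sum_add_distrib]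
  rw [Prod.fst_neg, neg_sub_left, norm_neg, add_comm] at h
  rw [h]
  exact le_add_of_nonneg_left (sq_nonneg _)

/-- A finitely supported sequence as an element of `ℓ²(ℤ)`. -/
def finsuppToL2 (c : ℤ →₀ ℝ) : lp (fun _ : ℤ => ℝ) 2 :=
  ⟨fun n => c n, memℓp_gen (summable_of_ne_finset_zero (s := c.support) fun n hn => by
    simp [Finsupp.notMem_support_iff.1 hn])⟩

theorem lp_two_norm_sq (x : lp (fun _ : ℤ => ℝ) 2) : ‖x‖ ^ 2 = ∑' n, x n ^ 2 := by
  have := lp.norm_rpow_eq_tsum (p := 2) (by norm_num) x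
  simpa using this

theorem mul_norm_finsuppToL2_sub_sq_le [IsProbabilityMeasure P] (hX : IsStationaryWithPSD P X S)
    (hH : AEStronglyMeasurable H volume) (hZ : IsFilterOutput P X S H Z)
    (hη : IsWhiteNoise P X η v) (c d : ℤ →₀ ℝ) :
    v * ‖finsuppToL2 c - finsuppToL2 d‖ ^ 2
      ≤ ‖c.sum (fun n a => a • sampleVec hZ hη fs n)
          - d.sum fun n a => a • sampleVec hZ hη fs n‖ ^ 2 := by
  have h := mul_sum_sq_le_norm_sq (fs := fs) hX hH hZ hη (c - d).support
    fun n => (c - d) n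
  have h1 : ∑ n ∈ (c - d).support, (c - d) n • sampleVec hZ hη fs n
      = c.sum (fun n a => a • sampleVec hZ hη fs n)
          - d.sum fun n a => a • sampleVec hZ hη fs n :=
    Finsupp.sum_sub_index (h := fun n a => a • sampleVec hZ hη fs n) fun n a b => sub_smul a b _
  rw [h1] at h
  rw [lp_two_norm_sq, tsum_eq_sum (s := (c - d).support)]
  · exact h
  · intro n hn
    have h2 := Finsupp.notMem_support_iff.1 hn
    have : (finsuppToL2 c - finsuppToL2 d) n = (c - d) n := rfl
    rw [this, h2]
    norm_num

/-- Every vector of the closed span of the samples is a sum of the samples with square-summable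
coefficients, because the noise makes the coefficients of a convergent sequence of finite sums
converge in `ℓ²`. -/
theorem exists_isL2Sum_of_mem_closure [IsProbabilityMeasure P] (hv : 0 < v)
    (hX : IsStationaryWithPSD P X S)
    (hH : AEStronglyMeasurable H volume) (hZ : IsFilterOutput P X S H Z)
    (hη : IsWhiteNoise P X η v) {u : Lp ℝ 2 P}
    (hu : u ∈ (sampleSpan hZ hη fs).topologicalClosure) :
    ∃ w : ℤ → ℝ, IsL2Sum P (quantizedSamples fs Z η) w u := by
  obtain ⟨a, ha, hlim⟩ := mem_closure_iff_seq_limit.1 hu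
  choose c hc using fun k => Finsupp.mem_span_range_iff_exists_finsupp.1 (ha k)
  have hcs : CauchySeq fun k => finsuppToL2 (c k) := by
    rw [Metric.cauchySeq_iff]
    intro ε hε
    obtain ⟨N, hN⟩ := Metric.cauchySeq_iff.1 hlim.cauchySeq (Real.sqrt v * ε) (by positivity)
    refine ⟨N, fun k hk l hl => ?_⟩
    have h1 := mul_norm_finsuppToL2_sub_sq_le (fs := fs) hX hH hZ hη (c k) (c l)
    rw [hc, hc, ← dist_eq_norm, ← dist_eq_norm] at h1
    have h2 := pow_lt_pow_left₀ (hN k hk l hl) dist_nonneg two_ne_zero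
    rw [mul_pow, Real.sq_sqrt hv.le] at h2
    exact lt_of_pow_lt_pow_left₀ 2 hε.le (lt_of_mul_lt_mul_left (h1.trans_lt h2) hv.le)
  obtain ⟨w, hw⟩ := cauchySeq_tendsto_of_complete hcs
  refine ⟨w, ?_, Lp.memLp u, c, ?_, ?_⟩
  · have := (lp.memℓp w).summable (by norm_num)
    simpa using this
  · have h1 := ((tendsto_iff_norm_sub_tendsto_zero.1 hw).pow 2)
    simp only [lp_two_norm_sq] at h1
    rw [zero_pow two_ne_zero] at h1
    exact h1
  · have h1 := tendsto_iff_edist_tendsto_0.1 hlim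
    refine h1.congr fun k => ?_
    rw [edist_comm, Lp.edist_def, ← hc k]
    refine eLpNorm_congr_ae ?_
    filter_upwards [MemLp.coeFn_finset_sum_smul_toLp
      (memLp_quantizedSamples hZ hη fs) (c k).support (c k)] with ω h2
    exact congrArg (u ω - ·) h2

/-- The value is attained by projecting each `X(t)` onto the closed span of the samples. -/
theorem residual_mem_linearMSEs_isL2Sum [IsProbabilityMeasure P] (hfs : 0 < fs) (hv : 0 < v)
    (hX : IsStationaryWithPSD P X S)
    (hH : AEStronglyMeasurable H volume) (hZ : IsFilterOutput P X S H Z)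
    (hη : IsWhiteNoise P X η v) :
    (∫ f, S f) - ∫ f in (-fs / 2)..(fs / 2), mmseIntegrand fs v S H f
      ∈ linearMSEs P X (IsL2Sum P (quantizedSamples fs Z η)) := by
  set K := (sampleSpan hZ hη fs).topologicalClosure with hK
  have : CompleteSpace K := (Submodule.isClosed_topologicalClosure _).completeSpace_coe
  let Xhat : ℝ → Lp ℝ 2 P := fun t => K.starProjection (hX.vec t)
  have hmem : ∀ t, Xhat t ∈ K := fun t => K.starProjection_apply_mem _
  choose w hw using fun t => exists_isL2Sum_of_mem_closure hv hX hH hZ hη (hmem t)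
  have hmse : meanSquaredError P X (fun t => Xhat t)
      = fun t => (∫ f, S f) - explainedVariance fs v S H t := by
    ext t
    rw [meanSquaredError_eq_norm_sq hX t (u := Xhat t) EventuallyEq.rfl]
    refine le_antisymm (le_of_forall_pos_lt_add fun ε hε => ?_)
      (residual_le_norm_sub_sq hfs hv hX hH hZ hη t (hmem t))
    obtain ⟨u, hu, hlt⟩ := exists_norm_sub_sq_lt hfs hv hX hH hZ hη t hε
    refine lt_of_le_of_lt (pow_le_pow_left₀ (norm_nonneg _) ?_ 2) hlt
    rw [K.starProjection_minimal]
    exact ciInf_le (f := fun x : K => ‖hX.vec t - x‖)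
      ⟨0, by rintro _ ⟨x, rfl⟩; exact norm_nonneg _⟩
      ⟨u, Submodule.le_topologicalClosure _ hu⟩
  refine ⟨w, fun t => Xhat t, hw, fun T => ?_, ?_⟩
  · rw [hmse]
    exact (continuous_const.sub
      (continuous_explainedVariance hfs hv hX hH hZ hη)).intervalIntegrable _ _
  · rw [hmse]
    exact tendsto_average_residual hfs hv hX hH hZ hη

/-! ### Reconstructions by finite sums -/

theorem isSeriesSum_finset_sum {Y : ℤ → Ω → ℝ} (hY : ∀ n, MemLp (Y n) 2 P) (c : ℤ →₀ ℝ) :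
    IsSeriesSum P Y c fun ω => ∑ n ∈ c.support, c n * Y n ω := by
  refine ⟨summable_of_ne_finset_zero (s := c.support) fun n hn => by
      simp [Finsupp.notMem_support_iff.1 hn],
    memLp_finsetSum _ fun n _ => (hY n).const_mul _, ?_⟩
  refine tendsto_const_nhds.congr' ?_
  filter_upwards [eventually_ge_atTop (c.support.sup Int.natAbs)] with N hN
  have hsub : c.support ⊆ Finset.Icc (-(N : ℤ)) N := by
    intro n hn
    have : n.natAbs ≤ N := (Finset.le_sup hn).trans hN
    rw [Finset.mem_Icc]
    omega
  have h0 : (fun ω => ∑ n ∈ c.support, c n * Y n ω - ∑ n ∈ Finset.Icc (-(N : ℤ)) N, c n * Y n ω)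
      = 0 := by
    ext ω
    rw [Finset.sum_subset hsub fun n _ hn => by
      rw [Finsupp.notMem_support_iff.1 hn, zero_mul]]
    simp
  rw [h0, eLpNorm_zero]

/-- Measurable selection of approximants of a continuous curve from a separable set: the first
member of a dense sequence that is close enough. -/
theorem exists_measurable_norm_sub_sq_lt {E : Type*} [NormedAddCommGroup E] {K : Set E}
    (hK : TopologicalSpace.IsSeparable K) {x : ℝ → E} (hx : Continuous x) {b : ℝ → ℝ}
    (hb : Continuous b) (h : ∀ t, ∃ u ∈ K, ‖x t - u‖ ^ 2 < b t) :
    ∃ (d : ℕ → E) (j : ℝ → ℕ), (∀ k, d k ∈ K) ∧ (∀ t, ‖x t - d (j t)‖ ^ 2 < b t) ∧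
      Measurable fun t => ‖x t - d (j t)‖ ^ 2 := by
  classical
  have hsep : TopologicalSpace.SeparableSpace K := hK.separableSpace
  obtain ⟨u₀, hu₀, -⟩ := h 0
  have : Nonempty K := ⟨⟨u₀, hu₀⟩⟩
  let d : ℕ → K := TopologicalSpace.denseSeq K
  have herr : ∀ k, Continuous fun t => ‖x t - d k‖ ^ 2 := fun k =>
    (hx.sub continuous_const).norm.pow 2
  have hex : ∀ t, ∃ k, ‖x t - d k‖ ^ 2 < b t := by
    intro t
    obtain ⟨u, hu, hlt⟩ := h t
    have hopen : IsOpen {y : K | ‖x t - y‖ ^ 2 < b t} := isOpen_lt (by fun_prop) continuous_const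
    obtain ⟨k, hk⟩ := (TopologicalSpace.denseRange_denseSeq K).exists_mem_open hopen
      ⟨⟨u, hu⟩, hlt⟩
    exact ⟨k, hk⟩
  have hjm : Measurable fun t => Nat.find (hex t) := measurable_find hex fun k =>
    (isOpen_lt (herr k) hb).measurableSet
  refine ⟨fun k => d k, fun t => Nat.find (hex t), fun k => (d k).2, fun t => Nat.find_spec (hex t),
    ?_⟩
  exact (measurable_from_prod_countable_right (f := fun q : ℕ × ℝ => ‖x q.2 - d q.1‖ ^ 2)
      fun k => (herr k).measurable).comp (hjm.prodMk measurable_id)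

/-- A nonnegative perturbation bounded by the integrable function `(1 + t²)⁻¹` does not change the
limit of the time averages. -/
theorem tendsto_average_of_le_add_inv {m g : ℝ → ℝ} {L : ℝ} (hm : Continuous m)
    (hg : ∀ T : ℝ, IntervalIntegrable g volume (-T) T) (hlow : ∀ t, m t ≤ g t)
    (hup : ∀ t, g t ≤ m t + (1 + t ^ 2)⁻¹)
    (hL : Tendsto (fun T : ℝ => 1 / (2 * T) * ∫ t in (-T)..T, m t) atTop (𝓝 L)) :
    Tendsto (fun T : ℝ => 1 / (2 * T) * ∫ t in (-T)..T, g t) atTop (𝓝 L) := by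
  have hz : Tendsto (fun T : ℝ => 1 / (2 * T)) atTop (𝓝 0) :=
    tendsto_const_nhds.div_atTop (tendsto_id.const_mul_atTop two_pos)
  have hbig := hL.add (hz.mul_const Real.pi)
  rw [zero_mul, add_zero] at hbig
  refine tendsto_of_tendsto_of_tendsto_of_le_of_le' hL hbig ?_ ?_
  · filter_upwards [eventually_gt_atTop 0] with T hT
    exact mul_le_mul_of_nonneg_left (intervalIntegral.integral_mono_on (by linarith)
      (hm.intervalIntegrable _ _) (hg T) fun t _ => hlow t) (by positivity)
  · filter_upwards [eventually_gt_atTop 0] with T hT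
    rw [← mul_add]
    refine mul_le_mul_of_nonneg_left ?_ (by positivity)
    have hi : IntervalIntegrable (fun t : ℝ => (1 + t ^ 2)⁻¹) volume (-T) T :=
      integrable_inv_one_add_sq.intervalIntegrable
    have h1 : ∫ t in (-T)..T, g t ≤ ∫ t in (-T)..T, (m t + (1 + t ^ 2)⁻¹) :=
      intervalIntegral.integral_mono_on (by linarith) (hg T)
        ((hm.intervalIntegrable _ _).add hi) fun t _ => hup t
    have h2 : ∫ t in (-T)..T, (1 + t ^ 2)⁻¹ ≤ Real.pi := by
      rw [intervalIntegral.integral_of_le (by linarith), ← integral_univ_inv_one_add_sq]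
      exact setIntegral_le_integral integrable_inv_one_add_sq
        (Eventually.of_forall fun t => by positivity)
    rw [intervalIntegral.integral_add (hm.intervalIntegrable _ _) hi] at h1
    linarith

/-- The value is attained by series as well: take, at each time `t`, a finite sum whose error
exceeds the residual variance by less than `(1 + t²)⁻¹`. -/
theorem residual_mem_linearMSEs_isSeriesSum [IsProbabilityMeasure P] (hfs : 0 < fs) (hv : 0 < v)
    (hX : IsStationaryWithPSD P X S)
    (hH : AEStronglyMeasurable H volume) (hZ : IsFilterOutput P X S H Z)
    (hη : IsWhiteNoise P X η v) :
    (∫ f, S f) - ∫ f in (-fs / 2)..(fs / 2), mmseIntegrand fs v S H f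
      ∈ linearMSEs P X (IsSeriesSum P (quantizedSamples fs Z η)) := by
  have hmc : Continuous fun t => (∫ f, S f) - explainedVariance fs v S H t :=
    continuous_const.sub (continuous_explainedVariance hfs hv hX hH hZ hη)
  have hbc : Continuous fun t : ℝ => (1 + t ^ 2)⁻¹ :=
    (by fun_prop : Continuous fun t : ℝ => 1 + t ^ 2).inv₀ fun t => by positivity
  have hsep : TopologicalSpace.IsSeparable (sampleSpan hZ hη fs : Set (Lp ℝ 2 P)) :=
    (Set.countable_range (sampleVec hZ hη fs)).isSeparable.span (R := ℝ)
  obtain ⟨d, j, hd, hlt, hmeas⟩ := exists_measurable_norm_sub_sq_lt hsep hX.continuous_vec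
    (hmc.add hbc) fun t => exists_norm_sub_sq_lt hfs hv hX hH hZ hη t (by positivity)
  choose c hc using fun k => Finsupp.mem_span_range_iff_exists_finsupp.1 (hd k)
  have hmse : meanSquaredError P X (fun t ω =>
      ∑ n ∈ (c (j t)).support, c (j t) n * quantizedSamples fs Z η n ω)
      = fun t => ‖hX.vec t - d (j t)‖ ^ 2 := by
    ext t
    refine meanSquaredError_eq_norm_sq hX t ?_
    rw [← hc (j t)]
    exact MemLp.coeFn_finset_sum_smul_toLp (memLp_quantizedSamples hZ hη fs) _ _
  have hint : ∀ T : ℝ, IntervalIntegrable (fun t => ‖hX.vec t - d (j t)‖ ^ 2) volume (-T) T := by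
    intro T
    refine ((hmc.add hbc).intervalIntegrable (-T) T).mono_fun hmeas.aestronglyMeasurable
      (Eventually.of_forall fun t => ?_)
    beta_reduce
    rw [Real.norm_of_nonneg (sq_nonneg _)]
    exact (hlt t).le.trans (le_abs_self _)
  refine ⟨fun t => c (j t), _, fun t =>
    isSeriesSum_finset_sum (memLp_quantizedSamples hZ hη fs) (c (j t)), ?_, ?_⟩
  · rw [hmse]; exact hint
  · rw [hmse]
    exact tendsto_average_of_le_add_inv hmc hint
      (fun t => residual_le_norm_sub_sq hfs hv hX hH hZ hη t
        (Submodule.le_topologicalClosure _ (hd (j t))))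
      (fun t => (hlt t).le) (tendsto_average_residual hfs hv hX hH hZ hη)

end Samples

end

theorem mainTheorem9 {Ω : Type*} [MeasurableSpace Ω] (P : Measure Ω) [IsProbabilityMeasure P]
    (X Z : ℝ → Ω → ℝ) (η : ℤ → Ω → ℝ) (S : ℝ → ℝ) (H : ℝ → ℂ) (fs σ : ℝ)
    (hfs : 0 < fs) (hσ : 0 < σ)
    (hX : IsStationaryWithPSD P X S)
    (hH : AEStronglyMeasurable H volume)
    (hZ : IsFilterOutput P X S H Z)
    (hη : IsWhiteNoise P X η (σ ^ 2)) :
    (∀ᵐ f : ℝ, Summable (fun k : ℤ => S (f - fs * k) * ‖H (f - fs * k)‖ ^ 2) ∧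
      Summable (fun k : ℤ => S (f - fs * k) ^ 2 * ‖H (f - fs * k)‖ ^ 2)) ∧
    IntervalIntegrable (mmseIntegrand fs (σ ^ 2) S H) volume (-fs / 2) (fs / 2) ∧
    IsLeast (linearMSEs P X (IsL2Sum P (quantizedSamples fs Z η)))
      ((∫ f, S f) - ∫ f in (-fs / 2)..(fs / 2), mmseIntegrand fs (σ ^ 2) S H f) ∧
    IsGLB (linearMSEs P X (IsSeriesSum P (quantizedSamples fs Z η)))
      ((∫ f, S f) - ∫ f in (-fs / 2)..(fs / 2), mmseIntegrand fs (σ ^ 2) S H f) := by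
  have hv : 0 < σ ^ 2 := by positivity
  have hS := hX.psd_integrable
  have hSH := hZ.integrable_psd_mul hX hH
  refine ⟨?_, ?_, ⟨residual_mem_linearMSEs_isL2Sum hfs hv hX hH hZ hη, fun D hD => ?_⟩,
    IsLeast.isGLB ⟨residual_mem_linearMSEs_isSeriesSum hfs hv hX hH hZ hη, fun D hD => ?_⟩⟩
  · filter_upwards [ae_summable_psd hfs hS hSH] with f hf
    exact ⟨hf.2, summable_sq_mul_norm_sq (fun _ => hX.psd_nonneg _) hf.1 hf.2⟩
  · rw [intervalIntegrable_iff_integrableOn_Ioc_of_le (by linarith)]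
    have := integrableOn_mmseIntegrand hfs hv hS hX.psd_nonneg hH hSH (-fs / 2)
    rwa [show -fs / 2 + fs = fs / 2 by ring] at this
  · exact residual_le_of_mem_linearMSEs hfs hv hX hH hZ hη
      (fun w V ⟨_, hV, c, _, h⟩ => exists_mem_closure_of_tendsto hZ hη hV _ _ h) hD
  · exact residual_le_of_mem_linearMSEs hfs hv hX hH hZ hη
      (fun w V ⟨_, hV, h⟩ => exists_mem_closure_of_tendsto hZ hη hV _ _ h) hD
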